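/- Let $\mu_{\min}>1$, $\epsilon\in(0,1)$, $\mu_{\max}=\epsilon^{-2}\mu_{\min}$, $\mathcal A=[\mu_{\min},\mu_{\max}]$, $\Omega=(0,1)$. For $\mu\in\mathcal A$ let $u_\mu$ be the solution of $-u_\mu''+\mu^2u_\mu=0$ on $\Omega$ with $u_\mu(0)=1$ and $u_\mu(1)=0$ for all $\mu\in\mathcal A$; or, alternatively, with $u_\mu(0)=1$ and $u_\mu'(1)=0$ for all $\mu\in\mathcal A$ (that is, $u_\mu(x)=\cosh(\mu(1-x))/\cosh\mu$). The following holds in both cases. Let $\rho_\mu$ be the probability measure on $[0,1]$ with density $u_\mu/\int_0^1u_\mu$. For probability measures $\rho,\sigma$ on $[0,1]$ let $\mathrm{OT}(\rho,\sigma)^2$ be the infimum of $\int\tfrac12|x-y|^2\,d\pi(x,y)$ over all couplings $\pi$ of $\rho$ and $\sigma$. Then the functional $\sigma\mapsto\frac1{|\mathcal A|}\int_{\mathcal A}\mathrm{OT}(\rho_\mu,\sigma)^2\,d\mu$ on the probability measures on $[0,1]$ has a unique minimizer $\bar\rho$, the OT barycenter of the family $(\rho_\mu)_{\mu\in\mathcal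 A}$ with uniform weights. For $\mu\in\mathcal A$ let $\psi^c_\mu$ be the function on $\Omega$ with $\int_\Omega\psi^c_\mu=0$ such that $y\mapsto y-\partial_y\psi^c_\mu(y)$ is the optimal transport (Monge) map from $\bar\rho$ to $\rho_\mu$. Let $\bar\mu=\frac{\mu_{\max}-\mu_{\min}}{\log\mu_{\max}-\log\mu_{\min}}$. Then $\bar\mu\in\mathcal A$ and $$\inf_{\xi\in\mathrm{span}\{\psi^c_\mu:\mu\in\mathcal A\}}\ \sup_{\mu\in\mathcal A}\ \inf_{\substack{w\in\mathbb R,\ \Phi_\mu^{-1}(y)=y-w\,\partial_y\xi(y)\\ \Phi_\mu^{-1}:\Omega\to\Omega\text{ is a bijection}}}\ \|u_{\bar\mu}-u_\mu\circ\Phi_\mu^{-1}\|_{L^2(\Omega)}\ \le\ e^{-\mu_{\min}}(4+\epsilon).$$ Consequently, for $n=m=1$ the Kolmogorov $n$-$m$-width $$\inf_{\substack{V\subset L^2(\Omega)\\ \dim V=n}}\ \inf_{\substack{W\subset\mathrm{span}\{\psi^c_\mu:\mu\in\mathcal A\}\\ \dim W=m}}\ \sup_{\mu\in\mathcal A}\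 \inf_{\substack{\xi\in W,\ \Phi_\mu^{-1}(y)=y-\partial_y\xi(y)\\ \Phi_\mu^{-1}:\Omega\to\Omega\text{ is a bijection}}}\ \inf_{v\in V}\ \|v-u_\mu\circ\Phi_\mu^{-1}\|_{L^2(\Omega)}$$ is also at most $e^{-\mu_{\min}}(4+\epsilon)$. -/

import Mathlib

open MeasureTheory Set
open scoped ENNReal

noncomputable section

namespace BoundaryLayer

/-! ### The boundary value problem on `(0, 1)` -/

/-- `u` is continuous on `[0, 1]`, of class `C²` on `(0, 1)`, and satisfies
`-u'' + μ² u = 0` on `(0, 1)` and `u(0) = 1`. -/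
structure SolvesODE (μ : ℝ) (u : ℝ → ℝ) : Prop where
  continuousOn : ContinuousOn u (Icc 0 1)
  contDiffOn : ContDiffOn ℝ 2 u (Ioo 0 1)
  equation : ∀ x ∈ Ioo (0 : ℝ) 1, -deriv (deriv u) x + μ ^ 2 * u x = 0
  left_end : u 0 = 1

/-- The solution with the end condition `u(1) = 0`. -/
def IsDirichletSolution (μ : ℝ) (u : ℝ → ℝ) : Prop :=
  SolvesODE μ u ∧ u 1 = 0

/-- The solution with the end condition `u'(1) = 0` (one-sided derivative). -/
def IsNeumannSolution (μ : ℝ) (u : ℝ → ℝ) : Prop :=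
  SolvesODE μ u ∧ HasDerivWithinAt u 0 (Icc 0 1) 1

/-! ### Optimal transport on `[0, 1]` with cost `|x - y|² / 2` -/

/-- Probability measures on `[0, 1]`, regarded as measures on the line. -/
def IsProbOnUnit (σ : Measure ℝ) : Prop :=
  IsProbabilityMeasure σ ∧ σ (Icc 0 1)ᶜ = 0

/-- Transport plans with marginals `ρ` and `σ`. -/
def IsPlan (ρ σ : Measure ℝ) (π : Measure (ℝ × ℝ)) : Prop :=
  π.map Prod.fst = ρ ∧ π.map Prod.snd = σ

/-- The squared optimal transport distance `OT(ρ, σ)²`. -/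
def otSq (ρ σ : Measure ℝ) : ℝ≥0∞ :=
  ⨅ (π : Measure (ℝ × ℝ)) (_ : IsPlan ρ σ π),
    ∫⁻ p, ENNReal.ofReal ((1 / 2) * |p.1 - p.2| ^ 2) ∂π

/-- `T` is an optimal (Monge) map from `ρ` to `σ`. -/
def IsMongeMap (ρ σ : Measure ℝ) (T : ℝ → ℝ) : Prop :=
  Measurable T ∧ ρ.map T = σ ∧
    ∫⁻ x, ENNReal.ofReal ((1 / 2) * |T x - x| ^ 2) ∂ρ = otSq ρ σ

/-- The barycenter functional of the family `ρ μ`, `μ ∈ A`, with uniform weights. -/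
def barycenterCost (A : Set ℝ) (ρ : ℝ → Measure ℝ) (σ : Measure ℝ) : ℝ≥0∞ :=
  ⨍⁻ μ in A, otSq (ρ μ) σ ∂volume

/-- `σ` is an OT barycenter, with uniform weights, of the family `ρ μ`, `μ ∈ A`. -/
def IsOTBarycenter (A : Set ℝ) (ρ : ℝ → Measure ℝ) (σ : Measure ℝ) : Prop :=
  IsProbOnUnit σ ∧ ∀ σ', IsProbOnUnit σ' → barycenterCost A ρ σ ≤ barycenterCost A ρ σ'

/-- The measure with density `ρ(u) = u / ∫ u` on `[0, 1]`. -/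
def densityMeasure (u : ℝ → ℝ) : Measure ℝ :=
  (volume.restrict (Icc 0 1)).withDensity
    (fun x => ENNReal.ofReal (u x / ∫ y in (0 : ℝ)..1, u y))

/-- `ψ` is the centred potential of the transport from `ρ` to `σ`:
`T(y) = y - ψ'(y)` on `(0, 1)` for the Monge map `T`, and `∫ ψ = 0`. -/
def IsCentredPotential (ρ σ : Measure ℝ) (ψ : ℝ → ℝ) : Prop :=
  (∃ T, IsMongeMap ρ σ T ∧ ∀ y ∈ Ioo (0 : ℝ) 1, HasDerivAt ψ (y - T y) y) ∧
    IntegrableOn ψ (Ioo 0 1) ∧ ∫ y in Ioo (0 : ℝ) 1, ψ y = 0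

/-- The span of the centred potentials from `ρbar` to the members `ρ μ` of the family. -/
def potentialSpan (A : Set ℝ) (ρ : ℝ → Measure ℝ) (ρbar : Measure ℝ) :
    Submodule ℝ (ℝ → ℝ) :=
  Submodule.span ℝ {ψ | ∃ μ ∈ A, IsCentredPotential ρbar (ρ μ) ψ}

/-! ### Registration -/

/-- The map `Φ⁻¹(y) = y - w ξ'(y)`. -/
def invMap (w : ℝ) (ξ : ℝ → ℝ) (y : ℝ) : ℝ := y - w * deriv ξ y

/-- The `L²(0, 1)` norm. -/
def l2norm (f : ℝ → ℝ) : ℝ≥0∞ := eLpNorm f 2 (volume.restrict (Ioo 0 1))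

/-- Worst-case error of registration to the single reference function `v` with a single
transport mode taken from `S`:
`inf_{ξ ∈ S} sup_{μ ∈ A} inf_{w : Φ⁻¹ a bijection of (0, 1)} ‖v - u_μ ∘ Φ⁻¹‖`. -/
def registrationError (A : Set ℝ) (u : ℝ → ℝ → ℝ) (S : Submodule ℝ (ℝ → ℝ)) (v : ℝ → ℝ) :
    ℝ≥0∞ :=
  ⨅ ξ ∈ S, ⨆ μ ∈ A, ⨅ (w : ℝ) (_ : BijOn (invMap w ξ) (Ioo 0 1) (Ioo 0 1)),
    l2norm (fun y => v y - u μ (invMap w ξ y))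

/-- The Kolmogorov `n`-`m`-width with transport modes taken from `S`: the best worst-case
error with an `n`-dimensional subspace `V` of `L²(0, 1)` in the reference domain and an
`m`-dimensional space `W` of transport modes. -/
def nmWidth (A : Set ℝ) (u : ℝ → ℝ → ℝ) (S : Submodule ℝ (ℝ → ℝ)) (n m : ℕ) : ℝ≥0∞ :=
  ⨅ (V : Submodule ℝ (Lp ℝ 2 (volume.restrict (Ioo (0 : ℝ) 1))))
    (_ : FiniteDimensional ℝ V ∧ Module.finrank ℝ V = n)
    (W : Submodule ℝ (ℝ → ℝ))
    (_ : W ≤ S ∧ FiniteDimensional ℝ W ∧ Module.finrank ℝ W = m),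
    ⨆ μ ∈ A, ⨅ ξ ∈ W, ⨅ (_ : BijOn (invMap 1 ξ) (Ioo 0 1) (Ioo 0 1)), ⨅ v ∈ V,
      l2norm (fun y => v y - u μ (invMap 1 ξ y))

/-- The logarithmic mean. -/
def logMean (a b : ℝ) : ℝ := (b - a) / (Real.log b - Real.log a)

end BoundaryLayer

end

/-! On the line, optimal transport couples measures through their quantile functions, and `OT`
squared is half the squared `L²(0,1)` distance between these functions (`otSq_map_map`). By the
bias–variance identity the barycenter is therefore unique, and its quantile function is the average
of the `Q μ` (`isOTBarycenter_iff`).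

Up to `exp (-μ)`, the layer `u μ` is `exp (-μ x)`. For exact exponential laws on the half-line, `Q μ
s = -log (1 - s) / μ`. Their average is the same function with parameter `m`, where `1 / m` is the
mean of `1 / μ`, so `m` is the logarithmic mean. Every transport map from the barycenter would be
the dilation `y ↦ (m / μ) y`, so a single mode would register the family without error.

The true layers are perturbations of this model. Put `a = μmin` and let `T` be the transport map
from the barycenter to the member `a`; the mode is the potential with derivative `y - T y`, and
`modeWeight` is the weight that is exact for dilations. The error is governed by `d = m y - a T y ≥
0`, which vanishes in the model and satisfies `exp (-m y) (exp d - 1) ≤ 2 exp (-a)`. For `μ ≤ m` the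
registered exponent interpolates between `m y` and `a T y`, which gives a uniform bound. For `μ > m`
it extrapolates by a factor `κ`, possibly large, but `κ² ≤ 2 m / a` (`logMean_ratio_sq_le`), and the
large error is confined to `y ≤ a / m`. Together with one `exp (-a)` for the profiles, the `L²`
error is at most `4 exp (-a)`. -/

noncomputable section

namespace BoundaryLayer

/-! ### Monotone rearrangement on the unit interval -/

/-- Lebesgue measure on `(0, 1)`. -/
abbrev unitLeb : Measure ℝ := volume.restrict (Ioo 0 1)

instance : IsProbabilityMeasure unitLeb := ⟨by simp [unitLeb]⟩

/-- Hoeffding's formula: for positive `x` and `y`, the product `x y` is the area of the set of `(s,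
t)` with `0 < s < x` and `0 < t < y`; then Tonelli. -/
lemma lintegral_mul_eq_lintegral_survival (π : Measure (ℝ × ℝ)) [SFinite π] :
    ∫⁻ p, ENNReal.ofReal p.1 * ENNReal.ofReal p.2 ∂π =
      ∫⁻ q, π (Ioi q.1 ×ˢ Ioi q.2)
        ∂((volume.restrict (Ioi (0 : ℝ))).prod (volume.restrict (Ioi (0 : ℝ)))) := by
  set κ := (volume.restrict (Ioi (0 : ℝ))).prod (volume.restrict (Ioi (0 : ℝ)))
  have hS : MeasurableSet {z : (ℝ × ℝ) × (ℝ × ℝ) | z.2.1 < z.1.1 ∧ z.2.2 < z.1.2} :=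
    (measurableSet_lt (f := fun z : (ℝ × ℝ) × (ℝ × ℝ) => z.2.1) (g := fun z => z.1.1)
      (by fun_prop) (by fun_prop)).inter
      (measurableSet_lt (f := fun z : (ℝ × ℝ) × (ℝ × ℝ) => z.2.2) (g := fun z => z.1.2)
        (by fun_prop) (by fun_prop))
  have h1 := Measure.prod_apply (μ := π) (ν := κ) hS
  have h2 := Measure.prod_apply_symm (μ := π) (ν := κ) hS
  rw [h1] at h2
  have h3 : (fun q : ℝ × ℝ => π (Ioi q.1 ×ˢ Ioi q.2)) = fun q => π ((fun x => (x, q)) ⁻¹'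
      {z : (ℝ × ℝ) × (ℝ × ℝ) | z.2.1 < z.1.1 ∧ z.2.2 < z.1.2}) := by
    ext q
    congr 1
  rw [h3, ← h2]
  refine lintegral_congr fun p => ?_
  · have : Prod.mk p ⁻¹' {z : (ℝ × ℝ) × (ℝ × ℝ) | z.2.1 < z.1.1 ∧ z.2.2 < z.1.2} =
        Iio p.1 ×ˢ Iio p.2 := by ext; simp
    rw [this, Measure.prod_prod, Measure.restrict_apply measurableSet_Iio,
      Measure.restrict_apply measurableSet_Iio, Iio_inter_Ioi, Iio_inter_Ioi,
      Real.volume_Ioo, Real.volume_Ioo, sub_zero, sub_zero]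

/-- Superlevel sets of monotone functions are upper sets of an interval, hence nested, and the
intersection is the smaller one. -/
lemma measure_inter_eq_min {f g : ℝ → ℝ} (hf : MonotoneOn f (Ioo 0 1))
    (hg : MonotoneOn g (Ioo 0 1)) (s t : ℝ) :
    min (volume ({v | s < f v} ∩ Ioo 0 1)) (volume ({v | t < g v} ∩ Ioo 0 1)) ≤
      volume (({v | s < f v} ∩ {v | t < g v}) ∩ Ioo (0 : ℝ) 1) := by
  by_cases h : {v | s < f v} ∩ Ioo 0 1 ⊆ {v | t < g v}
  · exact (min_le_left _ _).trans (measure_mono fun v hv => ⟨⟨hv.1, h hv⟩, hv.2⟩)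
  · obtain ⟨v, hv, hv'⟩ := not_subset.1 h
    refine (min_le_right _ _).trans (measure_mono fun x hx => ⟨⟨?_, hx.1⟩, hx.2⟩)
    have hvx : v < x := by
      by_contra! hxv
      exact hv' (lt_of_lt_of_le hx.1 (hg hx.2 hv.2 hxv))
    exact lt_of_lt_of_le hv.1 (hf hv.2 hx.2 hvx.le)

lemma aemeasurable_unitLeb_of_monotoneOn {f : ℝ → ℝ} (hf : MonotoneOn f (Ioo 0 1)) :
    AEMeasurable f unitLeb := aemeasurable_restrict_of_monotoneOn measurableSet_Ioo hf

/-- Fréchet–Hoeffding bound: a plan gives a quadrant at most the smaller of its two marginal masses,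
and the comonotone plan attains this. -/
lemma lintegral_mul_le_of_isPlan {P G : ℝ → ℝ} (hP : MonotoneOn P (Ioo 0 1))
    (hG : MonotoneOn G (Ioo 0 1)) {π : Measure (ℝ × ℝ)} [SFinite π]
    (hπ : IsPlan (unitLeb.map P) (unitLeb.map G) π) :
    ∫⁻ p, ENNReal.ofReal p.1 * ENNReal.ofReal p.2 ∂π ≤
      ∫⁻ p, ENNReal.ofReal p.1 * ENNReal.ofReal p.2 ∂(unitLeb.map fun v => (P v, G v)) := by
  have hPm := aemeasurable_unitLeb_of_monotoneOn hP
  have hGm := aemeasurable_unitLeb_of_monotoneOn hG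
  rw [lintegral_mul_eq_lintegral_survival, lintegral_mul_eq_lintegral_survival]
  refine lintegral_mono fun q => ?_
  rw [Measure.map_apply_of_aemeasurable (hPm.prodMk hGm) (measurableSet_Ioi.prod measurableSet_Ioi),
    Measure.restrict_apply' measurableSet_Ioo]
  refine le_trans (le_min ?_ ?_) (measure_inter_eq_min hP hG q.1 q.2)
  · have : volume ({v | q.1 < P v} ∩ Ioo 0 1) = π (Prod.fst ⁻¹' Ioi q.1) := by
      rw [← Measure.map_apply measurable_fst measurableSet_Ioi, hπ.1,
        Measure.map_apply_of_aemeasurable hPm measurableSet_Ioi,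
        Measure.restrict_apply' measurableSet_Ioo]
      rfl
    rw [this]
    exact measure_mono fun x hx => hx.1
  · have : volume ({v | q.2 < G v} ∩ Ioo 0 1) = π (Prod.snd ⁻¹' Ioi q.2) := by
      rw [← Measure.map_apply measurable_snd measurableSet_Ioi, hπ.2,
        Measure.map_apply_of_aemeasurable hGm measurableSet_Ioi,
        Measure.restrict_apply' measurableSet_Ioo]
      rfl
    rw [this]
    exact measure_mono fun x hx => hx.2

/-- The cost of a plan, completed by the correlation of its marginals, depends only on the
marginals. -/
lemma lintegral_cost_add_lintegral_mul {ρ σ : Measure ℝ} {π : Measure (ℝ × ℝ)}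
    (hπ : IsPlan ρ σ π) (hρ : ∀ᵐ x ∂ρ, 0 ≤ x) (hσ : ∀ᵐ x ∂σ, 0 ≤ x) :
    ∫⁻ p, ENNReal.ofReal ((1 / 2) * |p.1 - p.2| ^ 2) ∂π +
        ∫⁻ p, ENNReal.ofReal p.1 * ENNReal.ofReal p.2 ∂π =
      ∫⁻ x, ENNReal.ofReal (1 / 2 * x ^ 2) ∂ρ + ∫⁻ x, ENNReal.ofReal (1 / 2 * x ^ 2) ∂σ := by
  rw [← lintegral_add_left (by fun_prop)]
  have h1 : ∀ᵐ p ∂π, 0 ≤ p.1 := by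
    rw [← hπ.1] at hρ
    exact ae_of_ae_map measurable_fst.aemeasurable hρ
  have h2 : ∀ᵐ p ∂π, 0 ≤ p.2 := by
    rw [← hπ.2] at hσ
    exact ae_of_ae_map measurable_snd.aemeasurable hσ
  rw [← hπ.1, ← hπ.2, lintegral_map (by fun_prop) measurable_fst,
    lintegral_map (by fun_prop) measurable_snd, ← lintegral_add_left (by fun_prop)]
  refine lintegral_congr_ae ?_
  filter_upwards [h1, h2] with p hp1 hp2
  rw [← ENNReal.ofReal_mul hp1, ← ENNReal.ofReal_add (by positivity) (by positivity),
    ← ENNReal.ofReal_add (by positivity) (by positivity), sq_abs]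
  ring_nf

lemma isProbOnUnit_map {f : ℝ → ℝ} (hf : AEMeasurable f unitLeb)
    (hf1 : ∀ v ∈ Ioo (0 : ℝ) 1, f v ∈ Icc (0 : ℝ) 1) : IsProbOnUnit (unitLeb.map f) := by
  refine ⟨Measure.isProbabilityMeasure_map hf, ?_⟩
  rw [Measure.map_apply_of_aemeasurable hf measurableSet_Icc.compl,
    Measure.restrict_apply' measurableSet_Ioo]
  convert measure_empty (μ := (volume : Measure ℝ))
  ext v
  simp only [mem_inter_iff, mem_preimage, mem_compl_iff, mem_empty_iff_false, iff_false, not_and]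
  exact fun h1 h2 => h1 (hf1 v h2)

lemma IsProbOnUnit.ae_mem {σ : Measure ℝ} (h : IsProbOnUnit σ) : ∀ᵐ x ∂σ, x ∈ Icc (0 : ℝ) 1 :=
  h.2

/-- The monotone rearrangement is optimal on the line. -/
theorem otSq_map_map {P G : ℝ → ℝ} (hP : MonotoneOn P (Ioo 0 1)) (hG : MonotoneOn G (Ioo 0 1))
    (hP1 : ∀ v ∈ Ioo (0 : ℝ) 1, P v ∈ Icc (0 : ℝ) 1)
    (hG1 : ∀ v ∈ Ioo (0 : ℝ) 1, G v ∈ Icc (0 : ℝ) 1) :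
    otSq (unitLeb.map P) (unitLeb.map G) =
      ∫⁻ v, ENNReal.ofReal ((1 / 2) * |P v - G v| ^ 2) ∂unitLeb := by
  have hPm := aemeasurable_unitLeb_of_monotoneOn hP
  have hGm := aemeasurable_unitLeb_of_monotoneOn hG
  have hm := hPm.prodMk hGm
  have hpP := isProbOnUnit_map hPm hP1
  have hpG := isProbOnUnit_map hGm hG1
  set π₀ := unitLeb.map fun v => (P v, G v) with hπ₀
  have hplan : IsPlan (unitLeb.map P) (unitLeb.map G) π₀ :=
    ⟨AEMeasurable.map_map_of_aemeasurable measurable_fst.aemeasurable hm,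
     AEMeasurable.map_map_of_aemeasurable measurable_snd.aemeasurable hm⟩
  have hcost : ∫⁻ p, ENNReal.ofReal ((1 / 2) * |p.1 - p.2| ^ 2) ∂π₀ =
      ∫⁻ v, ENNReal.ofReal ((1 / 2) * |P v - G v| ^ 2) ∂unitLeb :=
    lintegral_map' (f := fun p : ℝ × ℝ => ENNReal.ofReal ((1 / 2) * |p.1 - p.2| ^ 2))
      (Measurable.aemeasurable (by fun_prop)) hm
  have hnP : ∀ᵐ x ∂(unitLeb.map P), 0 ≤ x := hpP.ae_mem.mono fun x hx => hx.1
  have hnG : ∀ᵐ x ∂(unitLeb.map G), 0 ≤ x := hpG.ae_mem.mono fun x hx => hx.1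
  have hfin : ∫⁻ p, ENNReal.ofReal p.1 * ENNReal.ofReal p.2 ∂π₀ ≠ ∞ := by
    rw [hπ₀, lintegral_map' (f := fun p : ℝ × ℝ => ENNReal.ofReal p.1 * ENNReal.ofReal p.2)
      (Measurable.aemeasurable (by fun_prop)) hm]
    refine ne_top_of_le_ne_top (b := ∫⁻ _, 1 ∂unitLeb) (by simp) ?_
    refine setLIntegral_mono' measurableSet_Ioo fun v hv => ?_
    calc _ ≤ (1 : ℝ≥0∞) * 1 := mul_le_mul'
            (ENNReal.ofReal_le_one.2 (hP1 v hv).2) (ENNReal.ofReal_le_one.2 (hG1 v hv).2)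
      _ = 1 := one_mul 1
  refine le_antisymm (hcost ▸ iInf₂_le π₀ hplan) (le_iInf₂ fun π hπ => ?_)
  have : IsProbabilityMeasure π := by
    have := hpP.1
    rw [← hπ.1] at this
    exact Measure.isProbabilityMeasure_of_map Prod.fst
  rw [← hcost]
  have e1 := lintegral_cost_add_lintegral_mul hπ hnP hnG
  rw [← lintegral_cost_add_lintegral_mul hplan hnP hnG] at e1
  have e2 := lintegral_mul_le_of_isPlan hP hG hπ
  -- Cost plus correlation is the same for both plans, so the larger correlation forces the smaller
  -- cost; cancelling requires a finite correlation.
  refine (ENNReal.add_le_add_iff_right hfin).1 ?_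
  rw [← e1]
  gcongr

/-- Every probability measure on `[0, 1]` is the image of Lebesgue measure under a monotone
map. -/
theorem IsProbOnUnit.exists_monotoneOn_map {σ : Measure ℝ} (hσ : IsProbOnUnit σ) :
    ∃ G : ℝ → ℝ, MonotoneOn G (Ioo 0 1) ∧ (∀ v ∈ Ioo (0 : ℝ) 1, G v ∈ Icc (0 : ℝ) 1) ∧
      unitLeb.map G = σ := by
  have := hσ.1
  set F := ProbabilityTheory.cdf σ
  have hF1 : F 1 = 1 := by
    rw [ProbabilityTheory.cdf_eq_real, measureReal_def,
      (prob_compl_eq_zero_iff measurableSet_Iic).1 <|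
      measure_mono_null (compl_subset_compl.2 Icc_subset_Iic_self) hσ.2]
    rfl
  have hF0 : ∀ x < 0, F x = 0 := fun x hx => by
    rw [ProbabilityTheory.cdf_eq_real, measureReal_def, measure_mono_null _ hσ.2]
    · rfl
    · exact fun y hy hy' => absurd hy'.1 (not_le.2 (lt_of_le_of_lt hy hx))
  set G : ℝ → ℝ := fun v => sInf {x | v ≤ F x}
  have hbdd : ∀ v ∈ Ioo (0 : ℝ) 1, ∀ x ∈ {x | v ≤ F x}, 0 ≤ x := fun v hv x hx => by
    by_contra! h
    have := hF0 x h
    have h2 : v ≤ F x := hx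
    linarith [hv.1]
  have hne : ∀ v ∈ Ioo (0 : ℝ) 1, (1 : ℝ) ∈ {x | v ≤ F x} := fun v hv => by
    simpa [hF1] using hv.2.le
  -- The generalized inverse is a lower adjoint of the distribution function; right continuity of
  -- `F` makes the infimum attained.
  have hgal : ∀ v ∈ Ioo (0 : ℝ) 1, ∀ x, G v ≤ x ↔ v ≤ F x := fun v hv x => by
    constructor
    · intro h
      refine ge_of_tendsto (F.right_continuous x |>.mono_left
        (nhdsWithin_mono x Ioi_subset_Ici_self)) ?_
      filter_upwards [self_mem_nhdsWithin] with y hy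
      obtain ⟨z, hz, hzy⟩ := exists_lt_of_csInf_lt ⟨1, hne v hv⟩ (lt_of_le_of_lt h hy)
      exact le_trans hz (F.mono hzy.le)
    · exact fun h => csInf_le ⟨0, hbdd v hv⟩ h
  have hmono : MonotoneOn G (Ioo 0 1) := fun v hv w hw hvw =>
    (hgal v hv _).2 (hvw.trans ((hgal w hw _).1 le_rfl))
  refine ⟨G, hmono, fun v hv => ⟨le_csInf ⟨1, hne v hv⟩ (hbdd v hv), (hgal v hv 1).2 (hne v hv)⟩,
    ?_⟩
  have hm := aemeasurable_unitLeb_of_monotoneOn hmono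
  have : IsProbabilityMeasure (unitLeb.map G) := Measure.isProbabilityMeasure_map hm
  refine Measure.ext_of_Iic _ _ fun x => ?_
  rw [Measure.map_apply_of_aemeasurable hm measurableSet_Iic,
    Measure.restrict_apply' measurableSet_Ioo]
  have hF : σ (Iic x) = ENNReal.ofReal (F x) := by
    rw [ProbabilityTheory.cdf_eq_real, ofReal_measureReal]
  have hset : G ⁻¹' Iic x ∩ Ioo 0 1 = Iic (F x) ∩ Ioo 0 1 := by
    ext v
    exact and_congr_left fun hv => hgal v hv x
  have h0 : 0 ≤ F x := ProbabilityTheory.cdf_nonneg σ x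
  have h1 : F x ≤ 1 := ProbabilityTheory.cdf_le_one σ x
  rw [hset, hF]
  refine le_antisymm ?_ ?_
  · refine (measure_mono (t := Ioc 0 (F x)) fun v hv => ⟨hv.2.1, hv.1⟩).trans ?_
    simp
  · refine le_trans ?_ (measure_mono (s := Ioo 0 (F x)) fun v hv =>
      ⟨hv.2.le, hv.1, hv.2.trans_le h1⟩)
    simp

/-! ### Barycenters on the line -/

/-- Bias–variance decomposition of the mean squared deviation from `g`. -/
lemma lintegral_half_sq_sub {ν : Measure ℝ} [IsProbabilityMeasure ν] {X : ℝ → ℝ}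
    (hX : AEStronglyMeasurable X ν) (hX1 : ∀ᵐ μ ∂ν, X μ ∈ Icc (0 : ℝ) 1) (g : ℝ) :
    ∫⁻ μ, ENNReal.ofReal ((1 / 2) * |X μ - g| ^ 2) ∂ν =
      ENNReal.ofReal ((1 / 2) * |(∫ μ, X μ ∂ν) - g| ^ 2) +
        ∫⁻ μ, ENNReal.ofReal ((1 / 2) * |X μ - ∫ μ, X μ ∂ν| ^ 2) ∂ν := by
  set m := ∫ μ, X μ ∂ν
  have hXi : Integrable X ν := Integrable.of_bound hX 1 (hX1.mono fun μ h => by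
    rw [Real.norm_eq_abs, abs_of_nonneg h.1]; exact h.2)
  have hX2 : Integrable (fun μ => X μ ^ 2) ν :=
    Integrable.of_bound (hX.pow 2) 1 (hX1.mono fun μ h => by
      rw [Real.norm_eq_abs, abs_of_nonneg (by positivity)]; exact pow_le_one₀ h.1 h.2)
  have hexp : ∀ c : ℝ, (fun μ => (1 / 2) * |X μ - c| ^ 2) =
      fun μ => (1 / 2) * X μ ^ 2 - c * X μ + 1 / 2 * c ^ 2 := fun c => by
    ext μ; rw [sq_abs]; ring
  have hint : ∀ c : ℝ, Integrable (fun μ => (1 / 2) * |X μ - c| ^ 2) ν := fun c => by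
    rw [hexp]
    exact ((hX2.const_mul _).sub (hXi.const_mul _)).add (integrable_const _)
  have hval : ∀ c : ℝ, ∫ μ, (1 / 2) * |X μ - c| ^ 2 ∂ν =
      1 / 2 * (∫ μ, X μ ^ 2 ∂ν) - c * m + 1 / 2 * c ^ 2 := fun c => by
    have e1 : ∫ μ, (1 / 2 * X μ ^ 2 - c * X μ + 1 / 2 * c ^ 2) ∂ν =
        ∫ μ, (1 / 2 * X μ ^ 2 - c * X μ) ∂ν + ∫ _, 1 / 2 * c ^ 2 ∂ν :=
      integral_add ((hX2.const_mul _).sub (hXi.const_mul _)) (integrable_const _)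
    rw [hexp, e1, integral_sub (hX2.const_mul _) (hXi.const_mul _), integral_const_mul,
      integral_const_mul]
    simp [m]
  rw [← ofReal_integral_eq_lintegral_ofReal (hint g) (ae_of_all _ fun μ => by positivity),
    ← ofReal_integral_eq_lintegral_ofReal (hint m) (ae_of_all _ fun μ => by positivity),
    ← ENNReal.ofReal_add (by positivity) (integral_nonneg fun μ => by positivity),
    hval, hval, sq_abs]
  congr 1
  ring

section Barycenter

variable {ν : Measure ℝ} [IsProbabilityMeasure ν] {Q : ℝ → ℝ → ℝ}

lemma integrable_quantile (hQm : Measurable (Function.uncurry Q))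
    (hQ1 : ∀ᵐ μ ∂ν, ∀ v ∈ Ioo (0 : ℝ) 1, Q μ v ∈ Icc (0 : ℝ) 1) {v : ℝ}
    (hv : v ∈ Ioo (0 : ℝ) 1) : Integrable (fun μ => Q μ v) ν :=
  Integrable.of_bound (hQm.of_uncurry_right).aestronglyMeasurable 1 (hQ1.mono fun μ h => by
    rw [Real.norm_eq_abs, abs_of_nonneg (h v hv).1]; exact (h v hv).2)

lemma monotoneOn_average (hQm : Measurable (Function.uncurry Q))
    (hQ1 : ∀ᵐ μ ∂ν, ∀ v ∈ Ioo (0 : ℝ) 1, Q μ v ∈ Icc (0 : ℝ) 1)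
    (hQ : ∀ᵐ μ ∂ν, MonotoneOn (Q μ) (Ioo 0 1)) :
    MonotoneOn (fun v => ∫ μ, Q μ v ∂ν) (Ioo 0 1) := fun _ hv _ hw hvw =>
  integral_mono_ae (integrable_quantile hQm hQ1 hv) (integrable_quantile hQm hQ1 hw)
    (hQ.mono fun _ h => h hv hw hvw)

lemma average_mem_Icc (hQm : Measurable (Function.uncurry Q))
    (hQ1 : ∀ᵐ μ ∂ν, ∀ v ∈ Ioo (0 : ℝ) 1, Q μ v ∈ Icc (0 : ℝ) 1) :
    ∀ v ∈ Ioo (0 : ℝ) 1, ∫ μ, Q μ v ∂ν ∈ Icc (0 : ℝ) 1 := fun v hv => by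
  refine ⟨integral_nonneg_of_ae (hQ1.mono fun μ h => (h v hv).1), ?_⟩
  have := integral_mono_ae (integrable_quantile hQm hQ1 hv) (integrable_const (μ := ν) (1 : ℝ))
    (hQ1.mono fun μ h => (h v hv).2)
  simpa using this

/-- The average squared distance to a family splits into the distance to the averaged quantile
function and a constant. -/
lemma lintegral_otSq_map {ρ : ℝ → Measure ℝ} (hQm : Measurable (Function.uncurry Q))
    (hQ1 : ∀ᵐ μ ∂ν, ∀ v ∈ Ioo (0 : ℝ) 1, Q μ v ∈ Icc (0 : ℝ) 1)
    (hQ : ∀ᵐ μ ∂ν, MonotoneOn (Q μ) (Ioo 0 1)) (hρ : ∀ᵐ μ ∂ν, ρ μ = unitLeb.map (Q μ))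
    {G : ℝ → ℝ} (hG : MonotoneOn G (Ioo 0 1))
    (hG1 : ∀ v ∈ Ioo (0 : ℝ) 1, G v ∈ Icc (0 : ℝ) 1) :
    ∫⁻ μ, otSq (ρ μ) (unitLeb.map G) ∂ν =
      ∫⁻ v, ENNReal.ofReal ((1 / 2) * |(∫ μ, Q μ v ∂ν) - G v| ^ 2) ∂unitLeb +
        ∫⁻ v, ∫⁻ μ, ENNReal.ofReal ((1 / 2) * |Q μ v - ∫ μ, Q μ v ∂ν| ^ 2) ∂ν ∂unitLeb := by
  have hGm := aemeasurable_unitLeb_of_monotoneOn hG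
  have hbm := aemeasurable_unitLeb_of_monotoneOn (monotoneOn_average hQm hQ1 hQ)
  have h1 : ∫⁻ μ, otSq (ρ μ) (unitLeb.map G) ∂ν =
      ∫⁻ μ, ∫⁻ v, ENNReal.ofReal ((1 / 2) * |Q μ v - G v| ^ 2) ∂unitLeb ∂ν := by
    refine lintegral_congr_ae ?_
    filter_upwards [hQ1, hQ, hρ] with μ a1 a2 a3
    rw [a3, otSq_map_map a2 hG a1 hG1]
  rw [h1, lintegral_lintegral_swap]
  · rw [← lintegral_add_left']
    · refine setLIntegral_congr_fun measurableSet_Ioo fun v hv => ?_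
      exact lintegral_half_sq_sub (hQm.of_uncurry_right).aestronglyMeasurable
        (hQ1.mono fun μ h => h v hv) (G v)
    · exact (((hbm.sub hGm).abs.pow_const 2).const_mul _).ennreal_ofReal
  · exact (((hQm.aemeasurable.sub hGm.comp_snd).abs.pow_const 2).const_mul _).ennreal_ofReal

/-- In `lintegral_otSq_map` the variance term is finite and does not involve `G`, so a minimizer
must make the bias term zero, that is, `G` equals the average almost everywhere. -/
theorem isOTBarycenter_iff {A : Set ℝ} {ρ : ℝ → Measure ℝ}
    (hν : ν = (volume.restrict A univ)⁻¹ • volume.restrict A)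
    (hQm : Measurable (Function.uncurry Q))
    (hQ1 : ∀ᵐ μ ∂ν, ∀ v ∈ Ioo (0 : ℝ) 1, Q μ v ∈ Icc (0 : ℝ) 1)
    (hQ : ∀ᵐ μ ∂ν, MonotoneOn (Q μ) (Ioo 0 1)) (hρ : ∀ᵐ μ ∂ν, ρ μ = unitLeb.map (Q μ))
    (σ : Measure ℝ) :
    IsOTBarycenter A ρ σ ↔ σ = unitLeb.map (fun v => ∫ μ, Q μ v ∂ν) := by
  have hcost : ∀ σ, barycenterCost A ρ σ = ∫⁻ μ, otSq (ρ μ) σ ∂ν := fun σ => by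
    rw [hν]; rfl
  have hbar := monotoneOn_average hQm hQ1 hQ
  have hbar1 := average_mem_Icc hQm hQ1
  have hbm := aemeasurable_unitLeb_of_monotoneOn hbar
  have hfin : ∫⁻ v, ∫⁻ μ, ENNReal.ofReal ((1 / 2) * |Q μ v - ∫ μ, Q μ v ∂ν| ^ 2) ∂ν ∂unitLeb
      ≠ ∞ := by
    refine ne_top_of_le_ne_top (b := ∫⁻ _, 1 ∂unitLeb) (by simp) ?_
    refine setLIntegral_mono' measurableSet_Ioo fun v hv => ?_
    refine (lintegral_mono_ae (g := fun _ => 1) ?_).trans (by simp)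
    filter_upwards [hQ1] with μ h
    obtain ⟨a1, a2⟩ := h v hv
    obtain ⟨b1, b2⟩ := hbar1 v hv
    refine ENNReal.ofReal_le_one.2 ?_
    have : |Q μ v - ∫ μ, Q μ v ∂ν| ≤ 1 := abs_le.2 ⟨by linarith, by linarith⟩
    have : |Q μ v - ∫ μ, Q μ v ∂ν| ^ 2 ≤ 1 := pow_le_one₀ (abs_nonneg _) this
    linarith
  have hmin := lintegral_otSq_map hQm hQ1 hQ hρ hbar hbar1
  simp only [sub_self, abs_zero, ne_eq, OfNat.ofNat_ne_zero, not_false_eq_true, zero_pow, mul_zero,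
    ENNReal.ofReal_zero, lintegral_zero, zero_add] at hmin
  constructor
  · rintro ⟨hσ, hle⟩
    obtain ⟨G, hG, hG1, rfl⟩ := hσ.exists_monotoneOn_map
    have h := hle _ (isProbOnUnit_map hbm hbar1)
    rw [hcost, hcost, hmin, lintegral_otSq_map hQm hQ1 hQ hρ hG hG1] at h
    have h0 : ∫⁻ v, ENNReal.ofReal ((1 / 2) * |(∫ μ, Q μ v ∂ν) - G v| ^ 2) ∂unitLeb = 0 := by
      have := ENNReal.le_sub_of_add_le_right hfin h
      simpa using this
    have hGm := aemeasurable_unitLeb_of_monotoneOn hG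
    have h0 := (lintegral_eq_zero_iff'
      (((hbm.sub hGm).abs.pow_const 2).const_mul (1 / 2)).ennreal_ofReal).1 h0
    refine Measure.map_congr ?_
    filter_upwards [h0] with v hv
    have hv' : (1 / 2) * |(∫ μ, Q μ v ∂ν) - G v| ^ 2 ≤ 0 := ENNReal.ofReal_eq_zero.1 hv
    have : |(∫ μ, Q μ v ∂ν) - G v| ^ 2 = 0 := le_antisymm (by linarith) (by positivity)
    have := abs_eq_zero.1 (pow_eq_zero_iff (two_ne_zero) |>.1 this)
    linarith
  · rintro rfl
    refine ⟨isProbOnUnit_map hbm hbar1, fun σ' hσ' => ?_⟩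
    obtain ⟨G, hG, hG1, rfl⟩ := hσ'.exists_monotoneOn_map
    rw [hcost, hcost, hmin, lintegral_otSq_map hQm hQ1 hQ hρ hG hG1]
    exact le_add_self

end Barycenter

/-! ### Solutions of the boundary value problem -/

lemma SolvesODE.exists_exp {μ : ℝ} {u : ℝ → ℝ} (hu : SolvesODE μ u) (hμ : 0 < μ) :
    ∃ α β : ℝ, α + β = 1 ∧
      EqOn u (fun x => α * Real.exp (μ * x) + β * Real.exp (-(μ * x))) (Icc 0 1) := by
  have hd : ∀ x ∈ Ioo (0 : ℝ) 1, HasDerivAt u (deriv u x) x := fun x hx =>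
    ((hu.contDiffOn.differentiableOn (by norm_num)).differentiableAt
      (isOpen_Ioo.mem_nhds hx)).hasDerivAt
  have hd2 : ∀ x ∈ Ioo (0 : ℝ) 1, HasDerivAt (deriv u) (μ ^ 2 * u x) x := fun x hx => by
    have h := hu.contDiffOn
    rw [show (2 : WithTop ℕ∞) = 1 + 1 by norm_num,
      contDiffOn_succ_iff_deriv_of_isOpen isOpen_Ioo] at h
    have := ((h.2.2.differentiableOn (by norm_num)).differentiableAt
      (isOpen_Ioo.mem_nhds hx)).hasDerivAt
    exact this.congr_deriv (by linarith [hu.equation x hx])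
  have he : ∀ c x : ℝ, HasDerivAt (fun x => Real.exp (c * x)) (c * Real.exp (c * x)) x :=
    fun c x => by simpa [mul_comm] using ((hasDerivAt_id x).const_mul c).exp
  -- Factoring the operator gives a first integral for each of `c = μ` and `c = -μ`; eliminating
  -- `u'` from the two yields `u`.
  have hconst : ∀ c : ℝ, c ^ 2 = μ ^ 2 → ∃ C : ℝ, ∀ x ∈ Ioo (0 : ℝ) 1,
      (deriv u x + c * u x) * Real.exp (-c * x) = C := fun c hc => by
    have hg : ∀ x ∈ Ioo (0 : ℝ) 1,
        HasDerivAt (fun x => (deriv u x + c * u x) * Real.exp (-c * x)) 0 x := fun x hx => by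
      refine (((hd2 x hx).add ((hd x hx).const_mul c)).mul (he (-c) x)).congr_deriv ?_
      simp only [Pi.add_apply, ← hc]
      ring
    refine isOpen_Ioo.exists_is_const_of_deriv_eq_zero isPreconnected_Ioo
      (fun x hx => (hg x hx).differentiableAt.differentiableWithinAt) fun x hx => (hg x hx).deriv
  obtain ⟨C₁, h1⟩ := hconst μ rfl
  obtain ⟨C₂, h2⟩ := hconst (-μ) (by ring)
  have heq : EqOn u (fun x => C₁ / (2 * μ) * Real.exp (μ * x) +
      (-C₂ / (2 * μ)) * Real.exp (-(μ * x))) (Icc 0 1) := by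
    refine EqOn.of_subset_closure (s := Ioo 0 1) (fun x hx => ?_) hu.continuousOn
      (by fun_prop) Ioo_subset_Icc_self (by rw [closure_Ioo (by norm_num)])
    have e1 := h1 x hx
    have e2 := h2 x hx
    have e3 : Real.exp (μ * x) * Real.exp (-(μ * x)) = 1 := by rw [← Real.exp_add]; simp
    rw [neg_neg] at e2
    rw [neg_mul] at e1
    rw [← e1, ← e2]
    field_simp
    linear_combination (-2 * μ * u x) * e3
  refine ⟨_, _, ?_, heq⟩
  have := heq (left_mem_Icc.2 zero_le_one)
  rw [hu.left_end] at this
  simpa using this.symm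

lemma IsDirichletSolution.eqOn {μ : ℝ} {u : ℝ → ℝ} (hu : IsDirichletSolution μ u) (hμ : 0 < μ) :
    EqOn u (fun x => Real.sinh (μ * (1 - x)) / Real.sinh μ) (Icc 0 1) := by
  obtain ⟨α, β, hαβ, h⟩ := hu.1.exists_exp hμ
  have h1 := h (right_mem_Icc.2 zero_le_one)
  simp only [hu.2, mul_one] at h1
  have hs : 0 < Real.sinh μ := Real.sinh_pos_iff.2 hμ
  have e3 : Real.exp μ * Real.exp (-μ) = 1 := by rw [← Real.exp_add]; simp
  have hα : α * (2 * Real.sinh μ) = -Real.exp (-μ) := by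
    rw [Real.sinh_eq]
    linear_combination -h1 - Real.exp (-μ) * hαβ
  have hβ : β * (2 * Real.sinh μ) = Real.exp μ := by
    rw [Real.sinh_eq] at hα ⊢
    linear_combination hαβ * (Real.exp μ - Real.exp (-μ)) - hα
  intro x hx
  rw [h hx, eq_div_iff hs.ne']
  have e4 : Real.exp (μ * (1 - x)) = Real.exp μ * Real.exp (-(μ * x)) := by
    rw [← Real.exp_add]; ring_nf
  have e5 : Real.exp (-(μ * (1 - x))) = Real.exp (-μ) * Real.exp (μ * x) := by
    rw [← Real.exp_add]; ring_nf
  rw [Real.sinh_eq (μ * (1 - x)), e4, e5]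
  linear_combination Real.exp (μ * x) / 2 * hα + Real.exp (-(μ * x)) / 2 * hβ

lemma IsNeumannSolution.eqOn {μ : ℝ} {u : ℝ → ℝ} (hu : IsNeumannSolution μ u) (hμ : 0 < μ) :
    EqOn u (fun x => Real.cosh (μ * (1 - x)) / Real.cosh μ) (Icc 0 1) := by
  obtain ⟨α, β, hαβ, h⟩ := hu.1.exists_exp hμ
  have he : ∀ c x : ℝ, HasDerivAt (fun x => Real.exp (c * x)) (c * Real.exp (c * x)) x :=
    fun c x => by simpa [mul_comm] using ((hasDerivAt_id x).const_mul c).exp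
  have hd : HasDerivWithinAt u (α * (μ * Real.exp (μ * 1)) + β * (-μ * Real.exp (-μ * 1)))
      (Icc 0 1) 1 := by
    refine HasDerivWithinAt.congr (((he μ 1).const_mul α).add
      ((he (-μ) 1).const_mul β)).hasDerivWithinAt (fun x hx => ?_) ?_
    · simp [h hx]
    · simp [h (right_mem_Icc.2 zero_le_one)]
  have h1 := (uniqueDiffOn_Icc (zero_lt_one (α := ℝ)) 1 (right_mem_Icc.2 zero_le_one)).eq_deriv
    _ hd hu.2
  have h1 : α * Real.exp μ = β * Real.exp (-μ) := by
    have : μ * (α * Real.exp μ - β * Real.exp (-μ)) = 0 := by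
      rw [← h1]; simp only [mul_one]; ring
    rcases mul_eq_zero.1 this with h | h <;> linarith
  have hs : 0 < Real.cosh μ := Real.cosh_pos μ
  have hα : α * (2 * Real.cosh μ) = Real.exp (-μ) := by
    rw [Real.cosh_eq]
    linear_combination h1 + Real.exp (-μ) * hαβ
  have hβ : β * (2 * Real.cosh μ) = Real.exp μ := by
    rw [Real.cosh_eq] at hα ⊢
    linear_combination hαβ * (Real.exp μ + Real.exp (-μ)) - hα
  intro x hx
  rw [h hx, eq_div_iff hs.ne']
  have e4 : Real.exp (μ * (1 - x)) = Real.exp μ * Real.exp (-(μ * x)) := by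
    rw [← Real.exp_add]; ring_nf
  have e5 : Real.exp (-(μ * (1 - x))) = Real.exp (-μ) * Real.exp (μ * x) := by
    rw [← Real.exp_add]; ring_nf
  rw [Real.cosh_eq (μ * (1 - x)), e4, e5]
  linear_combination Real.exp (μ * x) / 2 * hα + Real.exp (-(μ * x)) / 2 * hβ

/-! ### Quantile functions with prescribed density -/

lemma bijOn_Ioo_of_strictMonoOn {f : ℝ → ℝ} (hc : ContinuousOn f (Icc 0 1))
    (hm : StrictMonoOn f (Icc 0 1)) (h0 : f 0 = 0) (h1 : f 1 = 1) :
    BijOn f (Ioo 0 1) (Ioo 0 1) := by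
  refine ⟨fun x hx => ⟨?_, ?_⟩, (hm.mono Ioo_subset_Icc_self).injOn, ?_⟩
  · rw [← h0]; exact hm (left_mem_Icc.2 zero_le_one) (Ioo_subset_Icc_self hx) hx.1
  · rw [← h1]; exact hm (Ioo_subset_Icc_self hx) (right_mem_Icc.2 zero_le_one) hx.2
  · have := intermediate_value_Ioo zero_le_one hc
    rwa [h0, h1] at this

/-- `F` is the distribution function and `c` the reciprocal of the mass. The change of variables `F`
carries the density to Lebesgue measure, and `Q` undoes it. -/
lemma map_eq_densityMeasure {u U F Q : ℝ → ℝ} {c : ℝ} (hc : 0 < c) (hu : EqOn u U (Icc 0 1))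
    (hU : Continuous U) (hU0 : ∀ x ∈ Ioo (0 : ℝ) 1, 0 < U x)
    (hF : ∀ x, HasDerivAt F (c * U x) x) (hF0 : F 0 = 0) (hF1 : F 1 = 1)
    (hQ : Measurable Q) (hQF : ∀ x ∈ Ioo (0 : ℝ) 1, Q (F x) = x) :
    densityMeasure u = unitLeb.map Q := by
  have hFc : Continuous F := continuous_iff_continuousAt.2 fun x => (hF x).continuousAt
  have hFm : StrictMonoOn F (Icc 0 1) := by
    refine strictMonoOn_of_deriv_pos (convex_Icc 0 1) hFc.continuousOn fun x hx => ?_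
    rw [interior_Icc] at hx
    rw [(hF x).deriv]
    exact mul_pos hc (hU0 x hx)
  have hbij := bijOn_Ioo_of_strictMonoOn hFc.continuousOn hFm hF0 hF1
  have hI : c * ∫ y in (0 : ℝ)..1, u y = 1 := by
    have e : ∫ y in (0 : ℝ)..1, u y = ∫ y in (0 : ℝ)..1, U y :=
      intervalIntegral.integral_congr (by rwa [uIcc_of_le zero_le_one])
    rw [e, ← intervalIntegral.integral_const_mul,
      intervalIntegral.integral_eq_sub_of_hasDerivAt (fun x _ => hF x)
        ((hU.const_mul c).intervalIntegrable 0 1), hF0, hF1, sub_zero]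
  have hI' : ∀ x, u x / ∫ y in (0 : ℝ)..1, u y = c * u x := fun x => by
    have : (∫ y in (0 : ℝ)..1, u y) = 1 / c := by field_simp; linarith
    rw [this]; field_simp
  have hdens : densityMeasure u = unitLeb.withDensity fun x => ENNReal.ofReal
      |(ContinuousLinearMap.toSpanSingleton ℝ (c * U x)).det| := by
    rw [densityMeasure, ← Measure.restrict_congr_set (Ioo_ae_eq_Icc (a := (0 : ℝ)) (b := 1))]
    refine withDensity_congr_ae ?_
    filter_upwards [ae_restrict_mem measurableSet_Ioo] with x hx
    rw [hI', hu (Ioo_subset_Icc_self hx), 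
      ContinuousLinearMap.det_toSpanSingleton, abs_of_pos (mul_pos hc (hU0 x hx))]
  have hmap := map_withDensity_abs_det_fderiv_eq_addHaar (μ := (volume : Measure ℝ))
    measurableSet_Ioo.nullMeasurableSet (fun x _ => (hF x).hasFDerivAt.hasFDerivWithinAt) hbij.injOn
  rw [hbij.image_eq] at hmap
  rw [unitLeb, ← hmap, ← unitLeb, ← hdens, Measure.map_map hQ hFc.measurable]
  have hid : Q ∘ F =ᵐ[densityMeasure u] id := by
    rw [hdens]
    refine (withDensity_absolutelyContinuous _ _).ae_le ?_
    filter_upwards [ae_restrict_mem measurableSet_Ioo] with x hx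
    exact hQF x hx
  rw [Measure.map_congr hid, Measure.map_id]

/-! ### Quantile functions of the boundary layers -/

/-- The properties of the quantile functions `Q μ` of the densities proportional to `u_μ` that
enter the registration estimate. -/
structure IsLayerQuantile (Q : ℝ → ℝ → ℝ) : Prop where
  measurable : Measurable (Function.uncurry Q)
  continuous : ∀ μ, Continuous (Q μ)
  zero : ∀ μ, 0 < μ → Q μ 0 = 0
  one : ∀ μ, Q μ 1 = 1
  strictMonoOn : ∀ μ, 0 < μ → StrictMonoOn (Q μ) (Icc 0 1)
  -- In the exponential model `μ * Q μ s` is independent of `μ`, and this inequality and `le_exp`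
  -- are equalities for `s, s' < 1`.
  mul_sub_le : ∀ μ μ', 0 < μ → μ ≤ μ' → ∀ s ∈ Icc (0 : ℝ) 1, ∀ s' ∈ Icc (0 : ℝ) 1, s ≤ s' →
    μ * (Q μ s' - Q μ s) ≤ μ' * (Q μ' s' - Q μ' s)
  lt_of_lt : ∀ μ μ', 0 < μ → μ < μ' → ∀ s ∈ Ioo (0 : ℝ) 1, Q μ' s < Q μ s
  le_exp : ∀ μ, 0 < μ → ∀ s ∈ Icc (0 : ℝ) 1, 1 - s ≤ Real.exp (-(μ * Q μ s))
  exp_le : ∀ μ, 0 < μ → ∀ s ∈ Icc (0 : ℝ) 1,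
    Real.exp (-(μ * Q μ s)) ≤ 1 - s + 2 * Real.exp (-μ)

lemma arsinh_mul_sub_le {p q m m' : ℝ} (hq : 0 ≤ q) (hqp : q ≤ p) (hm : 0 ≤ m) (hmm : m ≤ m') :
    Real.arsinh (p * m) - Real.arsinh (q * m) ≤ Real.arsinh (p * m') - Real.arsinh (q * m') := by
  have hd : ∀ c x : ℝ, HasDerivAt (fun m => Real.arsinh (c * m)) ((√(1 + (c * x) ^ 2))⁻¹ * c) x :=
    fun c x => by simpa [mul_comm] using ((hasDerivAt_id x).const_mul c).arsinh
  have hmono : MonotoneOn (fun m => Real.arsinh (p * m) - Real.arsinh (q * m)) (Ici 0) := by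
    refine monotoneOn_of_deriv_nonneg (convex_Ici 0)
      (fun x _ => ((hd p x).sub (hd q x)).continuousAt.continuousWithinAt)
      (fun x _ => ((hd p x).sub (hd q x)).differentiableAt.differentiableWithinAt) fun x hx => ?_
    have hsub : HasDerivAt (fun m => Real.arsinh (p * m) - Real.arsinh (q * m)) _ x :=
      (hd p x).sub (hd q x)
    rw [hsub.deriv, sub_nonneg, ← div_eq_inv_mul, ← div_eq_inv_mul,
      div_le_div_iff₀ (by positivity) (by positivity)]
    have hp := hq.trans hqp
    refine le_of_sq_le_sq ?_ (by positivity)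
    have e1 := Real.sq_sqrt (show 0 ≤ 1 + (p * x) ^ 2 by positivity)
    have e2 := Real.sq_sqrt (show 0 ≤ 1 + (q * x) ^ 2 by positivity)
    rw [mul_pow q √_, mul_pow p √_, e1, e2]
    nlinarith [pow_le_pow_left₀ hq hqp 2]
  exact hmono hm (hm.trans hmm) hmm

/-- With `S = sinh x`, the squared derivative is `b² (1 + S²) / (1 + b² S²)`, which increases with
`S²` because `b < 1`. -/
lemma strictConvexOn_arsinh_mul_sinh {b : ℝ} (hb0 : 0 < b) (hb1 : b < 1) :
    StrictConvexOn ℝ (Ici 0) fun x => Real.arsinh (b * Real.sinh x) := by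
  have hd : ∀ x : ℝ, HasDerivAt (fun x => Real.arsinh (b * Real.sinh x))
      ((√(1 + (b * Real.sinh x) ^ 2))⁻¹ * (b * Real.cosh x)) x := fun x => by
    simpa using ((Real.hasDerivAt_sinh x).const_mul b).arsinh
  refine StrictMonoOn.strictConvexOn_of_deriv (convex_Ici 0)
    (fun x _ => (hd x).continuousAt.continuousWithinAt) ?_
  rw [interior_Ici]
  intro x hx y hy hxy
  rw [(hd x).deriv, (hd y).deriv, ← div_eq_inv_mul, ← div_eq_inv_mul,
    div_lt_div_iff₀ (by positivity) (by positivity)]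
  have hcx := Real.cosh_pos x
  have hcy := Real.cosh_pos y
  refine lt_of_pow_lt_pow_left₀ 2 (by positivity) ?_
  have e1 := Real.sq_sqrt (show 0 ≤ 1 + (b * Real.sinh x) ^ 2 by positivity)
  have e2 := Real.sq_sqrt (show 0 ≤ 1 + (b * Real.sinh y) ^ 2 by positivity)
  rw [mul_pow _ √_, mul_pow _ √_, e1, e2, mul_pow, mul_pow, mul_pow, mul_pow, Real.cosh_sq,
    Real.cosh_sq]
  have h1 : Real.sinh x ^ 2 < Real.sinh y ^ 2 :=
    pow_lt_pow_left₀ (Real.sinh_lt_sinh.2 hxy) (Real.sinh_nonneg_iff.2 (le_of_lt hx)) two_ne_zero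
  have h2 : b ^ 2 < 1 := pow_lt_one₀ hb0.le hb1 two_ne_zero
  have h3 : 0 < b ^ 2 * ((1 - b ^ 2) * (Real.sinh y ^ 2 - Real.sinh x ^ 2)) :=
    mul_pos (by positivity) (mul_pos (by linarith) (by linarith))
  linarith

/-- Slopes from the origin of a strictly convex function that vanishes there increase strictly. -/
lemma arsinh_mul_sinh_div_lt {b x y : ℝ} (hb0 : 0 < b) (hb1 : b < 1) (hx : 0 < x) (hxy : x < y) :
    Real.arsinh (b * Real.sinh x) / x < Real.arsinh (b * Real.sinh y) / y := by
  have hy := hx.trans hxy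
  have h1 : 0 < 1 - x / y := sub_pos.2 ((div_lt_one hy).2 hxy)
  have h := (strictConvexOn_arsinh_mul_sinh hb0 hb1).2 (self_mem_Ici (a := (0 : ℝ)))
    (mem_Ici.2 hy.le) hy.ne h1 (div_pos hx hy) (by ring)
  simp only [smul_eq_mul, mul_zero, Real.sinh_zero, Real.arsinh_zero, zero_add] at h
  rw [div_mul_cancel₀ _ hy.ne'] at h
  rw [div_lt_iff₀ hx]
  calc _ < _ := h
    _ = _ := by ring

lemma mul_exp_le_exp_arsinh {b x : ℝ} (hb0 : 0 ≤ b) (hb1 : b ≤ 1) :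
    b * Real.exp x ≤ Real.exp (Real.arsinh (b * Real.sinh x)) := by
  rw [Real.exp_arsinh, ← Real.sinh_add_cosh x, mul_add]
  gcongr
  refine Real.le_sqrt_of_sq_le ?_
  rw [mul_pow, Real.cosh_sq]
  nlinarith [pow_le_one₀ hb0 hb1 (n := 2)]

/-- Quantile function in terms of a root `β` of the survival probability. -/
def rootQuantile (k : ℕ) (β : ℝ → ℝ) (μ s : ℝ) : ℝ :=
  1 - k / μ * Real.arsinh (β s * Real.sinh (μ / k))

lemma exp_neg_mul_rootQuantile {k : ℕ} {β : ℝ → ℝ} {μ : ℝ} (hμ : 0 < μ) (s : ℝ) :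
    Real.exp (-(μ * rootQuantile k β μ s)) =
      Real.exp (-μ) * Real.exp (Real.arsinh (β s * Real.sinh (μ / k))) ^ k := by
  rw [rootQuantile, ← Real.exp_nat_mul, ← Real.exp_add]
  congr 1
  field_simp
  ring

/-- Treats both boundary conditions at once. Only the upper bound `hle` depends on the exponent and
is left to the two cases. -/
lemma isLayerQuantile_rootQuantile {k : ℕ} {β : ℝ → ℝ} (hk : 0 < k) (hβ : Continuous β)
    (hβ' : StrictAntiOn β (Icc 0 1)) (hβ0 : β 0 = 1) (hβ1 : β 1 = 0)
    (hβk : ∀ s ∈ Icc (0 : ℝ) 1, β s ^ k = 1 - s)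
    (hle : ∀ μ, 0 < μ → ∀ s ∈ Icc (0 : ℝ) 1,
      Real.exp (-μ) * Real.exp (Real.arsinh (β s * Real.sinh (μ / k))) ^ k ≤
        1 - s + 2 * Real.exp (-μ)) :
    IsLayerQuantile (rootQuantile k β) := by
  have hk' : (0 : ℝ) < k := by exact_mod_cast hk
  have hb0 : ∀ s ∈ Icc (0 : ℝ) 1, 0 ≤ β s := fun s hs => by
    rw [← hβ1]; exact hβ'.antitoneOn hs (right_mem_Icc.2 zero_le_one) hs.2
  have hb1 : ∀ s ∈ Icc (0 : ℝ) 1, β s ≤ 1 := fun s hs => by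
    rw [← hβ0]; exact hβ'.antitoneOn (left_mem_Icc.2 zero_le_one) hs hs.1
  have hsinh : ∀ μ : ℝ, 0 < μ → 0 < Real.sinh (μ / k) := fun μ hμ =>
    Real.sinh_pos_iff.2 (by positivity)
  refine ⟨?_, ?_, ?_, ?_, ?_, ?_, ?_, ?_, ?_⟩
  · have := Real.continuous_arsinh.measurable
    have := Real.continuous_sinh.measurable
    have := hβ.measurable
    unfold Function.uncurry rootQuantile
    fun_prop
  · intro μ
    have := Real.continuous_arsinh
    unfold rootQuantile
    fun_prop
  · intro μ hμ
    rw [rootQuantile, hβ0, one_mul, Real.arsinh_sinh]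
    field_simp
    ring
  · intro μ
    simp [rootQuantile, hβ1]
  · intro μ hμ s hs s' hs' hss
    refine sub_lt_sub_left (mul_lt_mul_of_pos_left ?_ (by positivity)) _
    exact Real.arsinh_strictMono (mul_lt_mul_of_pos_right (hβ' hs hs' hss) (hsinh μ hμ))
  · intro μ μ' hμ hμμ s hs s' hs' hss
    have e : ∀ μ : ℝ, 0 < μ → μ * (rootQuantile k β μ s' - rootQuantile k β μ s) =
        k * (Real.arsinh (β s * Real.sinh (μ / k)) - Real.arsinh (β s' * Real.sinh (μ / k))) :=
      fun μ hμ => by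
        rw [rootQuantile, rootQuantile]
        field_simp
        ring
    rw [e μ hμ, e μ' (hμ.trans_le hμμ)]
    refine mul_le_mul_of_nonneg_left (arsinh_mul_sub_le (hb0 s' hs') ?_ (hsinh μ hμ).le ?_) hk'.le
    · exact hβ'.antitoneOn hs hs' hss
    · exact Real.sinh_le_sinh.2 (by gcongr)
  · intro μ μ' hμ hμμ s hs
    have hμ' := hμ.trans hμμ
    have h0 : 0 < β s := by
      rw [← hβ1]; exact hβ' (Ioo_subset_Icc_self hs) (right_mem_Icc.2 zero_le_one) hs.2
    have h1 : β s < 1 := by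
      rw [← hβ0]; exact hβ' (left_mem_Icc.2 zero_le_one) (Ioo_subset_Icc_self hs) hs.1
    have := arsinh_mul_sinh_div_lt h0 h1 (div_pos hμ hk') (div_lt_div_of_pos_right hμμ hk')
    rw [div_div_eq_mul_div, div_div_eq_mul_div] at this
    simp only [rootQuantile, div_mul_eq_mul_div]
    rw [mul_comm (k : ℝ), mul_comm (k : ℝ)]
    linarith
  · intro μ hμ s hs
    rw [exp_neg_mul_rootQuantile hμ]
    calc 1 - s = Real.exp (-μ) * (β s * Real.exp (μ / k)) ^ k := by
          rw [mul_pow, hβk s hs, ← Real.exp_nat_mul, mul_div_cancel₀ _ hk'.ne', mul_left_comm,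
            ← Real.exp_add]
          simp
      _ ≤ _ := by
          have := mul_exp_le_exp_arsinh (x := μ / k) (hb0 s hs) (hb1 s hs)
          have := mul_nonneg (hb0 s hs) (Real.exp_pos (μ / k)).le
          gcongr
  · intro μ hμ s hs
    rw [exp_neg_mul_rootQuantile hμ]
    exact hle μ hμ s hs

/-- Quantile function of the solution with the condition `u'(1) = 0`. -/
def neumannQuantile : ℝ → ℝ → ℝ := rootQuantile 1 fun s => 1 - s

/-- Quantile function of the solution with the condition `u(1) = 0`. -/
def dirichletQuantile : ℝ → ℝ → ℝ := rootQuantile 2 fun s => √(1 - s)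

lemma isLayerQuantile_neumann : IsLayerQuantile neumannQuantile := by
  refine isLayerQuantile_rootQuantile one_pos (by fun_prop)
    (fun s _ s' _ h => by simpa using h) (by simp) (by simp) (by simp) fun μ hμ s hs => ?_
  have ht : 0 ≤ 1 - s := sub_nonneg.2 hs.2
  have hS : 0 ≤ (1 - s) * Real.sinh μ := mul_nonneg ht (Real.sinh_pos_iff.2 hμ).le
  rw [pow_one, Real.exp_arsinh, Nat.cast_one, div_one]
  have h1 : √(1 + ((1 - s) * Real.sinh μ) ^ 2) ≤ 1 + (1 - s) * Real.sinh μ :=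
    Real.sqrt_le_iff.2 ⟨by positivity, by nlinarith⟩
  have h2 : Real.exp (-μ) * Real.exp μ = 1 := by rw [← Real.exp_add]; simp
  have h3 := Real.exp_pos (-μ)
  calc _ ≤ Real.exp (-μ) * ((1 - s) * Real.sinh μ + (1 + (1 - s) * Real.sinh μ)) := by gcongr
    _ = (1 - s) * (Real.exp (-μ) * Real.exp μ) - (1 - s) * Real.exp (-μ) ^ 2 +
        Real.exp (-μ) := by rw [Real.sinh_eq]; ring
    _ ≤ _ := by
      rw [h2]
      have := mul_nonneg ht (sq_nonneg (Real.exp (-μ)))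
      linarith

lemma isLayerQuantile_dirichlet : IsLayerQuantile dirichletQuantile := by
  refine isLayerQuantile_rootQuantile two_pos (by fun_prop) (fun s _ s' hs' h => ?_) (by simp)
    (by simp) (fun s hs => Real.sq_sqrt (sub_nonneg.2 hs.2)) fun μ hμ s hs => ?_
  · exact Real.sqrt_lt_sqrt (sub_nonneg.2 hs'.2) (by linarith)
  have ht : 0 ≤ 1 - s := sub_nonneg.2 hs.2
  rw [Real.exp_arsinh, Nat.cast_ofNat]
  set S := √(1 - s) * Real.sinh (μ / 2) with hS
  -- This is `(x + y)² ≤ 2 x² + 2 y²`; its constant term is the source of the `2` in `exp_le`.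
  have h1 : (S + √(1 + S ^ 2)) ^ 2 ≤ 2 + 4 * S ^ 2 := by
    have := Real.sq_sqrt (show 0 ≤ 1 + S ^ 2 by positivity)
    nlinarith [sq_nonneg (S - √(1 + S ^ 2))]
  have h2 : 4 * S ^ 2 = (1 - s) * (Real.exp μ + Real.exp (-μ) - 2) := by
    have e1 : Real.exp μ = Real.exp (μ / 2) ^ 2 := by rw [← Real.exp_nat_mul]; ring_nf
    have e2 : Real.exp (-μ) = Real.exp (-(μ / 2)) ^ 2 := by rw [← Real.exp_nat_mul]; ring_nf
    have e3 : Real.exp (μ / 2) * Real.exp (-(μ / 2)) = 1 := by rw [← Real.exp_add]; simp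
    rw [hS, mul_pow, Real.sq_sqrt ht, Real.sinh_eq, e1, e2]
    linear_combination (-2) * (1 - s) * e3
  have h3 : Real.exp (-μ) * Real.exp μ = 1 := by rw [← Real.exp_add]; simp
  have h4 : Real.exp (-μ) ≤ 1 := Real.exp_le_one_iff.2 (by linarith)
  have h5 := Real.exp_pos (-μ)
  calc _ ≤ Real.exp (-μ) * (2 + 4 * S ^ 2) := by gcongr
    _ = (1 - s) * (Real.exp (-μ) * Real.exp μ) + 2 * Real.exp (-μ) +
        (1 - s) * (Real.exp (-μ) * (Real.exp (-μ) - 2)) := by rw [h2]; ring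
    _ ≤ _ := by
      rw [h3]
      have : (1 - s) * (Real.exp (-μ) * (Real.exp (-μ) - 2)) ≤ 0 :=
        mul_nonpos_of_nonneg_of_nonpos ht (mul_nonpos_of_nonneg_of_nonpos h5.le (by linarith))
      linarith

lemma densityMeasure_neumann {μ : ℝ} (hμ : 0 < μ) {u : ℝ → ℝ} (hu : IsNeumannSolution μ u) :
    densityMeasure u = unitLeb.map (neumannQuantile μ) := by
  have hs := Real.sinh_pos_iff.2 hμ
  have hc := Real.cosh_pos μ
  refine map_eq_densityMeasure (c := μ * Real.cosh μ / Real.sinh μ)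
    (F := fun x => 1 - Real.sinh (μ * (1 - x)) / Real.sinh μ) (by positivity) (hu.eqOn hμ)
    (by fun_prop) (fun x _ => div_pos (Real.cosh_pos _) hc) (fun x => ?_) (by simp [hs.ne'])
    (by simp) (isLayerQuantile_neumann.continuous μ).measurable fun x _ => ?_
  · have := (((((hasDerivAt_id x).const_sub 1).const_mul μ).sinh).div_const
      (Real.sinh μ)).const_sub 1
    refine this.congr_deriv ?_
    simp only [id]
    field_simp
  · simp only [neumannQuantile, rootQuantile, sub_sub_cancel, Nat.cast_one, div_one]
    rw [div_mul_cancel₀ _ hs.ne', Real.arsinh_sinh]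
    field_simp
    ring

/-- The tail integral of `sinh (μ (1 - x))` is proportional to `cosh (μ (1 - x)) - 1 = 2 sinh² (μ (1
- x) / 2)`. The survival function is thus a square, whence the square root in the quantile function.
-/
lemma densityMeasure_dirichlet {μ : ℝ} (hμ : 0 < μ) {u : ℝ → ℝ} (hu : IsDirichletSolution μ u) :
    densityMeasure u = unitLeb.map (dirichletQuantile μ) := by
  have hs := Real.sinh_pos_iff.2 (half_pos hμ)
  have hS := Real.sinh_pos_iff.2 hμ
  refine map_eq_densityMeasure (c := μ * Real.sinh μ / (2 * Real.sinh (μ / 2) ^ 2))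
    (F := fun x => 1 - (Real.sinh (μ / 2 * (1 - x)) / Real.sinh (μ / 2)) ^ 2) (by positivity)
    (hu.eqOn hμ) (by fun_prop)
    (fun x hx => div_pos (Real.sinh_pos_iff.2 (mul_pos hμ (sub_pos.2 hx.2))) hS)
    (fun x => ?_) (by simp [hs.ne'])
    (by simp) (isLayerQuantile_dirichlet.continuous μ).measurable fun x hx => ?_
  · have := ((((((hasDerivAt_id x).const_sub 1).const_mul (μ / 2)).sinh).div_const
      (Real.sinh (μ / 2))).pow 2).const_sub 1
    refine this.congr_deriv ?_
    have e : Real.sinh (μ * (1 - x)) =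
        2 * Real.sinh (μ / 2 * (1 - x)) * Real.cosh (μ / 2 * (1 - x)) := by
      rw [← Real.sinh_two_mul]; ring_nf
    simp only [id, e, Nat.cast_ofNat, Nat.add_one_sub_one, pow_one]
    field_simp
  · have hx' : 0 ≤ Real.sinh (μ / 2 * (1 - x)) / Real.sinh (μ / 2) :=
      div_nonneg (Real.sinh_nonneg_iff.2 (mul_nonneg (by linarith) (sub_nonneg.2 hx.2.le))) hs.le
    simp only [dirichletQuantile, rootQuantile, sub_sub_cancel, Nat.cast_ofNat]
    rw [Real.sqrt_sq hx', div_mul_cancel₀ _ hs.ne', Real.arsinh_sinh]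
    field_simp
    ring

/-! ### Distance of the boundary layers to exponentials -/

lemma cosh_profile {μ x : ℝ} (hμ : 0 < μ) (hx : x ∈ Icc (0 : ℝ) 1) :
    Real.cosh (μ * (1 - x)) / Real.cosh μ - Real.exp (-(μ * x)) ∈ Icc 0 (Real.exp (-μ)) := by
  have hc := Real.cosh_pos μ
  have e : Real.cosh (μ * (1 - x)) / Real.cosh μ - Real.exp (-(μ * x)) =
      Real.exp (-μ) * (Real.sinh (μ * x) / Real.cosh μ) := by
    field_simp
    have e4 : Real.exp (μ * (1 - x)) = Real.exp μ * Real.exp (-(μ * x)) := by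
      rw [← Real.exp_add]; ring_nf
    have e5 : Real.exp (-(μ * (1 - x))) = Real.exp (-μ) * Real.exp (μ * x) := by
      rw [← Real.exp_add]; ring_nf
    rw [Real.cosh_eq, Real.cosh_eq, Real.sinh_eq, e4, e5]
    ring
  have h0 : 0 ≤ Real.sinh (μ * x) := Real.sinh_nonneg_iff.2 (mul_nonneg hμ.le hx.1)
  have h1 : Real.sinh (μ * x) ≤ Real.cosh μ :=
    (Real.sinh_le_sinh.2 (by nlinarith [hx.2])).trans (Real.sinh_lt_cosh μ).le
  rw [e]
  refine ⟨by positivity, mul_le_of_le_one_right (Real.exp_pos _).le ((div_le_one hc).2 h1)⟩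

lemma sinh_profile {μ x : ℝ} (hμ : 0 < μ) (hx : x ∈ Icc (0 : ℝ) 1) :
    Real.exp (-(μ * x)) - Real.sinh (μ * (1 - x)) / Real.sinh μ ∈ Icc 0 (Real.exp (-μ)) := by
  have hc := Real.sinh_pos_iff.2 hμ
  have e : Real.exp (-(μ * x)) - Real.sinh (μ * (1 - x)) / Real.sinh μ =
      Real.exp (-μ) * (Real.sinh (μ * x) / Real.sinh μ) := by
    field_simp
    have e4 : Real.exp (μ * (1 - x)) = Real.exp μ * Real.exp (-(μ * x)) := by
      rw [← Real.exp_add]; ring_nf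
    have e5 : Real.exp (-(μ * (1 - x))) = Real.exp (-μ) * Real.exp (μ * x) := by
      rw [← Real.exp_add]; ring_nf
    rw [Real.sinh_eq, Real.sinh_eq, Real.sinh_eq, e4, e5]
    ring
  have h0 : 0 ≤ Real.sinh (μ * x) := Real.sinh_nonneg_iff.2 (mul_nonneg hμ.le hx.1)
  have h1 : Real.sinh (μ * x) ≤ Real.sinh μ := Real.sinh_le_sinh.2 (by nlinarith [hx.2])
  rw [e]
  refine ⟨by positivity, mul_le_of_le_one_right (Real.exp_pos _).le ((div_le_one hc).2 h1)⟩

/-! ### The logarithmic mean -/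

/-- This is `logMean_ratio_sq_le` with `b / a = exp L`. The ratio tends to `1` as `L → 0` and grows
like `L`, so it is compared with a simple `c`: `1 + L / 2` for `L ≤ 2` and `L` beyond. -/
lemma log_ratio_bound {L : ℝ} (hL : 0 < L) :
    (L * Real.exp L - Real.exp L + 1) ^ 2 * L ≤
      2 * (Real.exp L - 1) * (Real.exp L - 1 - L) ^ 2 := by
  have hser : 1 + L + L ^ 2 / 2 + L ^ 3 / 6 + L ^ 4 / 24 ≤ Real.exp L := by
    have := Real.sum_le_exp_of_nonneg hL.le 5
    simp only [Finset.sum_range_succ, Finset.sum_range_zero, Nat.factorial] at this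
    norm_num at this
    linarith
  set E := Real.exp L
  have hE : 0 < E - 1 - L := by
    have : 0 < L ^ 2 / 2 + L ^ 3 / 6 + L ^ 4 / 24 := by positivity
    linarith
  have key : ∀ c : ℝ, L * E - E + 1 ≤ c * (E - 1 - L) → c ^ 2 * L ≤ 2 * (E - 1) →
      (L * E - E + 1) ^ 2 * L ≤ 2 * (E - 1) * (E - 1 - L) ^ 2 := fun c h1 h2 => by
    have h0 : 0 ≤ L * E - E + 1 := by
      have h3 : 1 - L ≤ Real.exp (-L) := by linarith [Real.add_one_le_exp (-L)]
      have h4 : Real.exp (-L) * E = 1 := by rw [← Real.exp_add]; simp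
      nlinarith [Real.exp_pos L]
    calc _ ≤ (c * (E - 1 - L)) ^ 2 * L := by gcongr
      _ = c ^ 2 * L * (E - 1 - L) ^ 2 := by ring
      _ ≤ _ := by gcongr
  rcases le_total L 2 with h | h
  · refine key (1 + L / 2) ?_ ?_
    · have h3 : 0 ≤ (2 - L / 2) * (E - (1 + L + L ^ 2 / 2 + L ^ 3 / 6 + L ^ 4 / 24)) :=
        mul_nonneg (by linarith) (by linarith)
      have h4 : 0 ≤ L ^ 3 * (4 - L ^ 2) := mul_nonneg (by positivity) (by nlinarith)
      nlinarith
    · have : 0 < L ^ 3 := by positivity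
      have : 0 < L ^ 4 := by positivity
      nlinarith
  · refine key L ?_ ?_
    · have : 0 ≤ L ^ 2 * ((L - 2) * (L + 6)) :=
        mul_nonneg (by positivity) (mul_nonneg (by linarith) (by linarith))
      nlinarith
    · have : 0 ≤ L * ((L + 1) * (L - 9 / 2) ^ 2) := by positivity
      -- The series leaves `L (L³ - 8 L² + 12 L + 24) / 12` to be nonnegative, and the cubic
      -- dominates `(L + 1) (L - 9/2)²`.
      nlinarith

lemma logMean_eq {a b : ℝ} (ha : 0 < a) (hab : a < b) :
    ∃ L : ℝ, 0 < L ∧ b = a * Real.exp L ∧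
      logMean a b = a * (Real.exp L - 1) / L := by
  refine ⟨Real.log b - Real.log a, sub_pos.2 (Real.log_lt_log ha hab), ?_, ?_⟩
  · rw [Real.exp_sub, Real.exp_log (ha.trans hab), Real.exp_log ha]; field_simp
  · rw [Real.exp_sub, Real.exp_log (ha.trans hab), Real.exp_log ha, logMean]
    congr 1
    field_simp

lemma lt_logMean {a b : ℝ} (ha : 0 < a) (hab : a < b) : a < logMean a b := by
  obtain ⟨L, hL, -, h⟩ := logMean_eq ha hab
  rw [h, lt_div_iff₀ hL]
  have := Real.add_one_lt_exp hL.ne'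
  gcongr
  linarith

lemma logMean_lt {a b : ℝ} (ha : 0 < a) (hab : a < b) : logMean a b < b := by
  obtain ⟨L, hL, hb, h⟩ := logMean_eq ha hab
  rw [h, div_lt_iff₀ hL, hb, mul_assoc]
  have h3 : 1 - L < Real.exp (-L) := by linarith [Real.add_one_lt_exp (neg_ne_zero.2 hL.ne')]
  have h4 : Real.exp (-L) * Real.exp L = 1 := by rw [← Real.exp_add]; simp
  gcongr
  nlinarith [Real.exp_pos L]

lemma logMean_ratio_sq_le {a b : ℝ} (ha : 0 < a) (hab : a < b) :
    ((b - logMean a b) / (logMean a b - a)) ^ 2 ≤ 2 * (logMean a b / a) := by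
  have h1 := lt_logMean ha hab
  obtain ⟨L, hL, hb, h⟩ := logMean_eq ha hab
  have hE : 0 < Real.exp L - 1 - L := by linarith [Real.add_one_lt_exp hL.ne']
  have e : (b - logMean a b) / (logMean a b - a) =
      (L * Real.exp L - Real.exp L + 1) / (Real.exp L - 1 - L) := by
    have e1 : logMean a b - a = a * (Real.exp L - 1 - L) / L := by rw [h]; field_simp
    have e2 : b - logMean a b = a * (L * Real.exp L - Real.exp L + 1) / L := by
      rw [h, hb]; field_simp; ring
    rw [e1, e2]
    field_simp
  have e3 : 2 * (logMean a b / a) = 2 * (Real.exp L - 1) / L := by rw [h]; field_simp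
  rw [e, e3, div_pow, div_le_div_iff₀ (by positivity) hL]
  exact log_ratio_bound hL

/-! ### Uniform average over an interval -/

/-- The uniform probability measure on `[a, b]`. -/
def uniformOn (a b : ℝ) : Measure ℝ :=
  (volume.restrict (Icc a b) univ)⁻¹ • volume.restrict (Icc a b)

lemma isProbabilityMeasure_uniformOn {a b : ℝ} (hab : a < b) :
    IsProbabilityMeasure (uniformOn a b) := by
  refine ⟨?_⟩
  have h1 : volume (Icc a b) ≠ 0 := by simp [hab]
  have h2 : volume (Icc a b) ≠ ∞ := by simp
  simp only [uniformOn, Measure.smul_apply, smul_eq_mul, Measure.restrict_apply_univ]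
  exact ENNReal.inv_mul_cancel h1 h2

lemma ae_uniformOn_mem (a b : ℝ) : ∀ᵐ μ ∂(uniformOn a b), μ ∈ Icc a b :=
  Measure.ae_smul_measure (ae_restrict_mem measurableSet_Icc) _

/-- The logarithmic mean is the harmonic mean of the uniform law; this singles it out as the
parameter of the reference function. -/
lemma integral_inv_uniformOn {a b : ℝ} (ha : 0 < a) (hab : a < b) :
    ∫ μ, μ⁻¹ ∂(uniformOn a b) = (logMean a b)⁻¹ := by
  rw [uniformOn, integral_smul_measure, integral_Icc_eq_integral_Ioc,
    ← intervalIntegral.integral_of_le hab.le, integral_inv_of_pos ha (ha.trans hab),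
    Real.log_div (ha.trans hab).ne' ha.ne', logMean]
  simp [ENNReal.toReal_ofReal (sub_nonneg.2 hab.le)]
  field_simp

/-! ### The averaged quantile function and the transport to the extreme parameter -/

section Average

variable {Q : ℝ → ℝ → ℝ} {a b : ℝ}

lemma IsLayerQuantile.mem_Icc (hQ : IsLayerQuantile Q) {μ : ℝ} (hμ : 0 < μ) {s : ℝ}
    (hs : s ∈ Icc (0 : ℝ) 1) : Q μ s ∈ Icc (0 : ℝ) 1 := by
  have h := (hQ.strictMonoOn μ hμ).monotoneOn
  constructor
  · rw [← hQ.zero μ hμ]; exact h (left_mem_Icc.2 zero_le_one) hs hs.1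
  · rw [← hQ.one μ]; exact h hs (right_mem_Icc.2 zero_le_one) hs.2

/-- The averaged quantile function. -/
def averageQuantile (Q : ℝ → ℝ → ℝ) (a b s : ℝ) : ℝ := ∫ μ, Q μ s ∂(uniformOn a b)

lemma IsLayerQuantile.integrable (hQ : IsLayerQuantile Q) (ha : 0 < a) (hab : a < b) {s : ℝ}
    (hs : s ∈ Icc (0 : ℝ) 1) : Integrable (fun μ => Q μ s) (uniformOn a b) := by
  have := isProbabilityMeasure_uniformOn hab
  refine Integrable.of_bound (hQ.measurable.of_uncurry_right).aestronglyMeasurable 1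
    ((ae_uniformOn_mem a b).mono fun μ h => ?_)
  have := hQ.mem_Icc (ha.trans_le h.1) hs
  rw [Real.norm_eq_abs, abs_of_nonneg this.1]
  exact this.2

lemma integrable_inv_uniformOn (ha : 0 < a) (hab : a < b) :
    Integrable (fun μ : ℝ => μ⁻¹) (uniformOn a b) := by
  have := isProbabilityMeasure_uniformOn hab
  refine Integrable.of_bound measurable_inv.aestronglyMeasurable a⁻¹
    ((ae_uniformOn_mem a b).mono fun μ h => ?_)
  rw [Real.norm_eq_abs, abs_of_nonneg (inv_nonneg.2 (ha.trans_le h.1).le)]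
  exact inv_anti₀ ha h.1

lemma averageQuantile_zero (hQ : IsLayerQuantile Q) (ha : 0 < a) : averageQuantile Q a b 0 = 0 :=
  integral_eq_zero_of_ae ((ae_uniformOn_mem a b).mono fun μ h => hQ.zero μ (ha.trans_le h.1))

lemma averageQuantile_one (hQ : IsLayerQuantile Q) (hab : a < b) :
    averageQuantile Q a b 1 = 1 := by
  have := isProbabilityMeasure_uniformOn hab
  simp [averageQuantile, hQ.one]

lemma continuousOn_averageQuantile (hQ : IsLayerQuantile Q) (ha : 0 < a) (hab : a < b) :
    ContinuousOn (averageQuantile Q a b) (Icc 0 1) := by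
  have := isProbabilityMeasure_uniformOn hab
  refine continuousOn_of_dominated (bound := fun _ => 1)
    (fun s _ => (hQ.measurable.of_uncurry_right).aestronglyMeasurable) (fun s hs => ?_)
    (integrable_const _) (ae_of_all _ fun μ => (hQ.continuous μ).continuousOn)
  refine (ae_uniformOn_mem a b).mono fun μ h => ?_
  have := hQ.mem_Icc (ha.trans_le h.1) hs
  rw [Real.norm_eq_abs, abs_of_nonneg this.1]
  exact this.2

/-- Increments of `Q μ` are at least `a / μ` times those of `Q a`; averaging replaces `1 / μ` by `1
/ m`. This becomes the Lipschitz bound for the transport map. -/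
lemma mul_sub_le_averageQuantile (hQ : IsLayerQuantile Q) (ha : 0 < a) (hab : a < b) {s s' : ℝ}
    (hs : s ∈ Icc (0 : ℝ) 1) (hs' : s' ∈ Icc (0 : ℝ) 1) (hss : s ≤ s') :
    Q a s' - Q a s ≤ logMean a b / a * (averageQuantile Q a b s' - averageQuantile Q a b s) := by
  have hm := ha.trans (lt_logMean ha hab)
  have h : (a * (Q a s' - Q a s)) * (logMean a b)⁻¹ ≤
      averageQuantile Q a b s' - averageQuantile Q a b s := by
    rw [averageQuantile, averageQuantile, ← integral_sub (hQ.integrable ha hab hs')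
      (hQ.integrable ha hab hs), ← integral_inv_uniformOn ha hab, ← integral_const_mul]
    refine integral_mono_ae ((integrable_inv_uniformOn ha hab).const_mul _)
      ((hQ.integrable ha hab hs').sub (hQ.integrable ha hab hs))
      ((ae_uniformOn_mem a b).mono fun μ h => ?_)
    have hμ := ha.trans_le h.1
    have := hQ.mul_sub_le a μ ha h.1 s hs s' hs' hss
    simp only
    rw [← div_eq_mul_inv, div_le_iff₀ hμ]
    linarith
  calc Q a s' - Q a s = logMean a b / a * ((a * (Q a s' - Q a s)) * (logMean a b)⁻¹) := by
        field_simp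
    _ ≤ _ := by gcongr

lemma strictMonoOn_averageQuantile (hQ : IsLayerQuantile Q) (ha : 0 < a) (hab : a < b) :
    StrictMonoOn (averageQuantile Q a b) (Icc 0 1) := fun s hs s' hs' hss => by
  have h1 := mul_sub_le_averageQuantile hQ ha hab hs hs' hss.le
  have h2 := hQ.strictMonoOn a ha hs hs' hss
  have h3 : 0 < logMean a b / a := div_pos (ha.trans (lt_logMean ha hab)) ha
  have := pos_of_mul_pos_right (lt_of_lt_of_le (sub_pos.2 h2) h1) h3.le
  exact sub_pos.1 this

/-- Ensures that the transport map is not the identity, so that the mode spans a space of dimension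
one. -/
lemma averageQuantile_lt (hQ : IsLayerQuantile Q) (ha : 0 < a) (hab : a < b) {s : ℝ}
    (hs : s ∈ Ioo (0 : ℝ) 1) : averageQuantile Q a b s < Q a s := by
  have := isProbabilityMeasure_uniformOn hab
  have hs' := Ioo_subset_Icc_self hs
  have hae : ∀ᵐ μ ∂(uniformOn a b), 0 < Q a s - Q μ s := by
    have hne : ∀ᵐ μ ∂(uniformOn a b), μ ≠ a :=
      Measure.ae_smul_measure (ae_restrict_of_ae (by simp [ae_iff])) _
    filter_upwards [ae_uniformOn_mem a b, hne] with μ h1 h2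
    exact sub_pos.2 (hQ.lt_of_lt a μ ha (lt_of_le_of_ne h1.1 h2.symm) s hs)
  have hi := (integrable_const (μ := uniformOn a b) (Q a s)).sub (hQ.integrable ha hab hs')
  have he : ∫ μ, (Q a s - Q μ s) ∂(uniformOn a b) = Q a s - averageQuantile Q a b s := by
    rw [integral_sub (integrable_const _) (hQ.integrable ha hab hs'), averageQuantile]
    simp
  have h0 : 0 ≤ ∫ μ, (Q a s - Q μ s) ∂(uniformOn a b) :=
    integral_nonneg_of_ae (hae.mono fun _ h => h.le)
  rw [← sub_pos, ← he]
  refine lt_of_le_of_ne h0 fun h => ?_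
  have hz := (integral_eq_zero_iff_of_nonneg_ae (hae.mono fun _ h => h.le) hi).1 h.symm
  obtain ⟨μ, h1, h2⟩ := (hae.and hz).exists
  exact h1.ne' h2

lemma le_exp_averageQuantile (hQ : IsLayerQuantile Q) (ha : 0 < a) (hab : a < b) {s : ℝ}
    (hs : s ∈ Icc (0 : ℝ) 1) :
    1 - s ≤ Real.exp (-(logMean a b * averageQuantile Q a b s)) := by
  rcases eq_or_lt_of_le hs.2 with h1 | h1
  · rw [h1, sub_self]; exact (Real.exp_pos _).le
  have hm := ha.trans (lt_logMean ha hab)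
  have ht : 0 < 1 - s := sub_pos.2 h1
  have h : averageQuantile Q a b s ≤ -Real.log (1 - s) * (logMean a b)⁻¹ := by
    rw [averageQuantile, ← integral_inv_uniformOn ha hab, ← integral_const_mul]
    refine integral_mono_ae (hQ.integrable ha hab hs)
      ((integrable_inv_uniformOn ha hab).const_mul _)
      ((ae_uniformOn_mem a b).mono fun μ h => ?_)
    have hμ := ha.trans_le h.1
    have := (Real.log_le_iff_le_exp ht).2 (hQ.le_exp μ hμ s hs)
    simp only
    rw [← div_eq_mul_inv, le_div_iff₀ hμ]
    linarith
  rw [← div_eq_mul_inv, le_div_iff₀ hm] at h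
  rw [← Real.log_le_iff_le_exp ht]
  linarith

/-- The properties of the transport map `T` from the barycenter to the member with the smallest
parameter `a`, where `m` is the logarithmic mean of the parameters. -/
structure IsLayerTransport (a m : ℝ) (T : ℝ → ℝ) : Prop where
  continuous : Continuous T
  zero : T 0 = 0
  one : T 1 = 1
  strictMonoOn : StrictMonoOn T (Icc 0 1)
  sub_le : ∀ y ∈ Icc (0 : ℝ) 1, ∀ y' ∈ Icc (0 : ℝ) 1, y ≤ y' → T y' - T y ≤ m / a * (y' - y)
  exists_ne : ∃ y ∈ Ioo (0 : ℝ) 1, T y ≠ y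
  exp_le : ∀ y ∈ Icc (0 : ℝ) 1, Real.exp (-(a * T y)) ≤ Real.exp (-(m * y)) + 2 * Real.exp (-a)

lemma exists_layerTransport (hQ : IsLayerQuantile Q) (ha : 0 < a) (hab : a < b) :
    ∃ T : ℝ → ℝ, IsLayerTransport a (logMean a b) T ∧
      ∀ s ∈ Icc (0 : ℝ) 1, T (averageQuantile Q a b s) = Q a s := by
  have hr : 0 < logMean a b / a := div_pos (ha.trans (lt_logMean ha hab)) ha
  have hmono := strictMonoOn_averageQuantile hQ ha hab
  set B := averageQuantile Q a b
  have hB0 : B 0 = 0 := averageQuantile_zero hQ ha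
  have hB1 : B 1 = 1 := averageQuantile_one hQ hab
  have hsurj : ∀ y ∈ Icc (0 : ℝ) 1, ∃ s ∈ Icc (0 : ℝ) 1, B s = y := by
    have := intermediate_value_Icc zero_le_one (continuousOn_averageQuantile hQ ha hab)
    rw [show averageQuantile Q a b 0 = 0 from hB0,
      show averageQuantile Q a b 1 = 1 from hB1] at this
    exact this
  have hmaps : ∀ s ∈ Icc (0 : ℝ) 1, B s ∈ Icc (0 : ℝ) 1 := fun s hs => by
    constructor
    · rw [← hB0]; exact hmono.monotoneOn (left_mem_Icc.2 zero_le_one) hs hs.1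
    · rw [← hB1]; exact hmono.monotoneOn hs (right_mem_Icc.2 zero_le_one) hs.2
  choose! inv hinv hBinv using hsurj
  have hinv' : ∀ s ∈ Icc (0 : ℝ) 1, inv (B s) = s := fun s hs =>
    hmono.injOn (hinv _ (hmaps s hs)) hs (hBinv _ (hmaps s hs))
  have hinvmono : StrictMonoOn inv (Icc 0 1) := fun y hy y' hy' h => by
    by_contra! h'
    have := hmono.monotoneOn (hinv y' hy') (hinv y hy) h'
    rw [hBinv y hy, hBinv y' hy'] at this
    linarith
  have hsub : ∀ y ∈ Icc (0 : ℝ) 1, ∀ y' ∈ Icc (0 : ℝ) 1, y ≤ y' →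
      Q a (inv y') - Q a (inv y) ≤ logMean a b / a * (y' - y) := fun y hy y' hy' h => by
    have := mul_sub_le_averageQuantile hQ ha hab (hinv y hy) (hinv y' hy')
      (hinvmono.monotoneOn hy hy' h)
    rwa [show averageQuantile Q a b (inv y') = y' from hBinv y' hy',
      show averageQuantile Q a b (inv y) = y from hBinv y hy] at this
  have hmono' : StrictMonoOn (fun y => Q a (inv y)) (Icc 0 1) := fun y hy y' hy' h =>
    hQ.strictMonoOn a ha (hinv y hy) (hinv y' hy') (hinvmono hy hy' h)
  have hlip : LipschitzOnWith ⟨logMean a b / a, hr.le⟩ (fun y => Q a (inv y)) (Icc 0 1) := by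
    refine LipschitzOnWith.of_le_add_mul _ fun y hy y' hy' => ?_
    change Q a (inv y) ≤ Q a (inv y') + logMean a b / a * dist y y'
    rcases le_total y y' with h | h
    · have := hmono'.monotoneOn hy hy' h
      have : 0 ≤ logMean a b / a * dist y y' := by positivity
      linarith
    · have := hsub y' hy' y hy h
      rw [Real.dist_eq, abs_of_nonneg (sub_nonneg.2 h)]
      linarith
  -- On `[0, 1]` the map is `Q a` after the inverse of the averaged quantile function. Extending it
  -- to the line makes `y - T y` continuous everywhere, with a globally differentiable primitive.
  obtain ⟨T, hT, hTeq⟩ := hlip.extend_real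
  have hTB : ∀ s ∈ Icc (0 : ℝ) 1, T (B s) = Q a s := fun s hs => by
    rw [← hTeq (hmaps s hs)]
    exact congrArg (Q a) (hinv' s hs)
  refine ⟨T, ⟨hT.continuous, ?_, ?_, hmono'.congr hTeq, fun y hy y' hy' h => ?_, ?_,
    fun y hy => ?_⟩, hTB⟩
  · have := hTB 0 (left_mem_Icc.2 zero_le_one)
    rwa [hB0, hQ.zero a ha] at this
  · have := hTB 1 (right_mem_Icc.2 zero_le_one)
    rwa [hB1, hQ.one a] at this
  · rw [← hTeq hy, ← hTeq hy']
    exact hsub y hy y' hy' h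
  · have h2 : (1 / 2 : ℝ) ∈ Ioo (0 : ℝ) 1 := by norm_num
    have h2' := Ioo_subset_Icc_self h2
    refine ⟨B (1 / 2), ⟨?_, ?_⟩, ?_⟩
    · exact hB0.symm.trans_lt (hmono (left_mem_Icc.2 zero_le_one) h2' h2.1)
    · exact (hmono h2' (right_mem_Icc.2 zero_le_one) h2.2).trans_eq hB1
    · rw [hTB _ h2']
      exact (averageQuantile_lt hQ ha hab h2).ne'
  · rw [← hTeq hy]
    have h1 := hQ.exp_le a ha (inv y) (hinv y hy)
    have h2 := le_exp_averageQuantile hQ ha hab (hinv y hy)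
    rw [show averageQuantile Q a b (inv y) = y from hBinv y hy] at h2
    linarith

end Average

/-! ### Registration with the single mode `y - T y` -/

section Registration

variable {T : ℝ → ℝ} {a m μ : ℝ}

/-- The weight of the mode `y - T y` in the registration of the member with parameter `μ`. -/
def modeWeight (a m μ : ℝ) : ℝ := (m - μ) * a / (μ * (m - a))

lemma IsLayerTransport.mem_Icc (hT : IsLayerTransport a m T) {y : ℝ} (hy : y ∈ Icc (0 : ℝ) 1) :
    T y ∈ Icc (0 : ℝ) 1 := by
  have h := hT.strictMonoOn.monotoneOn
  constructor
  · rw [← hT.zero]; exact h (left_mem_Icc.2 zero_le_one) hy hy.1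
  · rw [← hT.one]; exact h hy (right_mem_Icc.2 zero_le_one) hy.2

/-- For `μ ≤ m` the map is a convex combination of the identity and `T`. For `μ > m` the weight is
negative, and the Lipschitz bound `m / a` on `T` keeps all slopes at least `m / μ`. -/
lemma IsLayerTransport.bijOn (hT : IsLayerTransport a m T) (ha : 0 < a) (ham : a < m)
    (hμ : a ≤ μ) :
    BijOn (fun y => y - modeWeight a m μ * (y - T y)) (Ioo 0 1) (Ioo 0 1) := by
  have hTc := hT.continuous
  have hμ0 := ha.trans_le hμ
  have hma : 0 < m - a := sub_pos.2 ham
  refine bijOn_Ioo_of_strictMonoOn (by fun_prop) (fun y hy y' hy' h => ?_) (by simp [hT.zero])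
    (by simp [hT.one])
  have h1 := hT.strictMonoOn hy hy' h
  have h2 := hT.sub_le y hy y' hy' h.le
  set w := modeWeight a m μ with hw
  have key : 0 < (1 - w) * (y' - y) + w * (T y' - T y) := by
    rcases le_or_gt μ m with hc | hc
    · have hw0 : 0 ≤ w := div_nonneg (mul_nonneg (sub_nonneg.2 hc) ha.le) (by positivity)
      have hw1 : w ≤ 1 := by
        rw [hw, modeWeight, div_le_one (by positivity)]
        nlinarith
      rcases eq_or_lt_of_le hw0 with h0 | h0
      · rw [← h0]; linarith
      · have := mul_nonneg (sub_nonneg.2 hw1) (sub_pos.2 h).le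
        have := mul_pos h0 (sub_pos.2 h1)
        linarith
    · have hw0 : w ≤ 0 := div_nonpos_of_nonpos_of_nonneg
        (mul_nonpos_of_nonpos_of_nonneg (sub_nonpos.2 hc.le) ha.le) (by positivity)
      have e : (1 - w) + w * (m / a) = m / μ := by
        rw [hw, modeWeight]; field_simp; ring
      have h3 := mul_le_mul_of_nonpos_left h2 hw0
      have h4 : 0 < m / μ * (y' - y) :=
        mul_pos (div_pos (ha.trans ham) hμ0) (sub_pos.2 h)
      rw [← e] at h4
      linarith
  linarith

/-- Explains the weight: if `a T y = m y`, the registered exponent is exactly `m y`. The remaining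
term is affine in the defect `m y - a T y`. -/
lemma mul_registration_eq (ham : a < m) (hμ : 0 < μ) (y : ℝ) :
    μ * (y - modeWeight a m μ * (y - T y)) =
      m * y - (m - μ) / (m - a) * (m * y - a * T y) := by
  have hma : m - a ≠ 0 := (sub_pos.2 ham).ne'
  rw [modeWeight]
  field_simp
  ring

lemma IsLayerTransport.mul_le (hT : IsLayerTransport a m T) (ha : 0 < a) {y : ℝ}
    (hy : y ∈ Icc (0 : ℝ) 1) : a * T y ≤ m * y := by
  have := hT.sub_le 0 (left_mem_Icc.2 zero_le_one) y hy hy.1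
  rw [hT.zero, sub_zero, sub_zero, div_mul_eq_mul_div, le_div_iff₀ ha] at this
  linarith

lemma IsLayerTransport.exp_sub_exp_le (hT : IsLayerTransport a m T) (ha : 0 < a) (ham : a < m)
    (hμ : a ≤ μ) (hμm : μ ≤ m) {y : ℝ} (hy : y ∈ Icc (0 : ℝ) 1) :
    |Real.exp (-(m * y)) - Real.exp (-(μ * (y - modeWeight a m μ * (y - T y))))| ≤
      2 * Real.exp (-a) := by
  rw [mul_registration_eq ham (ha.trans_le hμ)]
  have hma : 0 < m - a := sub_pos.2 ham
  have hd := sub_nonneg.2 (hT.mul_le ha hy)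
  have h0 : 0 ≤ (m - μ) / (m - a) := div_nonneg (sub_nonneg.2 hμm) hma.le
  have h1 : (m - μ) / (m - a) ≤ 1 := (div_le_one hma).2 (by linarith)
  have h2 := hT.exp_le y hy
  have h3 : Real.exp (-(m * y)) ≤
      Real.exp (-(m * y - (m - μ) / (m - a) * (m * y - a * T y))) :=
    Real.exp_le_exp.2 (by nlinarith)
  have h4 : Real.exp (-(m * y - (m - μ) / (m - a) * (m * y - a * T y))) ≤
      Real.exp (-(a * T y)) := Real.exp_le_exp.2 (by nlinarith)
  rw [abs_le]
  constructor <;> linarith [Real.exp_pos (-a)]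

/-- The difference is `exp (-m y) (1 - exp (-κ d))`, with `1 - exp (-κ d) ≤ κ d`; and `exp (-m y) d
≤ 2 exp (-a)` follows from `d ≤ exp d - 1`. -/
lemma IsLayerTransport.exp_sub_exp_le' (hT : IsLayerTransport a m T) (ha : 0 < a) (ham : a < m)
    (hμm : m ≤ μ) {y : ℝ} (hy : y ∈ Icc (0 : ℝ) 1) :
    |Real.exp (-(m * y)) - Real.exp (-(μ * (y - modeWeight a m μ * (y - T y))))| ≤
      min (Real.exp (-(m * y))) ((μ - m) / (m - a) * (2 * Real.exp (-a))) := by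
  rw [mul_registration_eq ham (ha.trans (ham.trans_le hμm))]
  have hma : 0 < m - a := sub_pos.2 ham
  have hd := sub_nonneg.2 (hT.mul_le ha hy)
  set d := m * y - a * T y with hd'
  have h0 : 0 ≤ (μ - m) / (m - a) := div_nonneg (sub_nonneg.2 hμm) hma.le
  set κ := (μ - m) / (m - a) with hκ
  have e1 : (m - μ) / (m - a) = -κ := by rw [hκ, ← neg_div, neg_sub]
  have e2 : Real.exp (-(m * y - (m - μ) / (m - a) * d)) =
      Real.exp (-(m * y)) * Real.exp (-(κ * d)) := by
    rw [e1, ← Real.exp_add]; ring_nf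
  have hp := Real.exp_pos (-(m * y))
  have h1 : Real.exp (-(κ * d)) ≤ 1 := Real.exp_le_one_iff.2 (by nlinarith)
  have h2 : 1 - κ * d ≤ Real.exp (-(κ * d)) := by linarith [Real.add_one_le_exp (-(κ * d))]
  have h3 : Real.exp (-(m * y)) * d ≤ 2 * Real.exp (-a) := by
    have h4 := hT.exp_le y hy
    have h5 : Real.exp (-(a * T y)) = Real.exp (-(m * y)) * Real.exp d := by
      rw [← Real.exp_add, hd']; ring_nf
    rw [h5] at h4
    nlinarith [Real.add_one_le_exp d]
  rw [e2, abs_of_nonneg (by nlinarith)]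
  refine le_min ?_ ?_
  · have := mul_pos hp (Real.exp_pos (-(κ * d)))
    linarith
  · calc _ ≤ κ * (Real.exp (-(m * y)) * d) := by nlinarith
      _ ≤ _ := by gcongr

end Registration

lemma l2norm_le_of_two_bounds {f : ℝ → ℝ} {c B₁ B₂ C : ℝ} (hc : 0 ≤ c) (hC : 0 ≤ C)
    (hB : B₂ ^ 2 ≤ C ^ 2)
    (h1 : ∀ y ∈ Ioo (0 : ℝ) 1, y ≤ c → |f y| ≤ B₁) (h2 : ∀ y ∈ Ioo (0 : ℝ) 1, c < y → |f y| ≤ B₂)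
    (h : (B₁ ^ 2 - B₂ ^ 2) * c ≤ C ^ 2 - B₂ ^ 2) : l2norm f ≤ ENNReal.ofReal C := by
  have hsq : ∫⁻ y in Ioo (0 : ℝ) 1, ‖f y‖ₑ ^ (2 : ℝ) ≤ ENNReal.ofReal (C ^ 2) := by
    -- A negative `B₁² - B₂²` is truncated to `0` by `ENNReal.ofReal`; the hypothesis `hB` covers
    -- that case.
    have hpt : ∀ y ∈ Ioo (0 : ℝ) 1, ‖f y‖ₑ ^ (2 : ℝ) ≤ ENNReal.ofReal (B₂ ^ 2) +
        (Iic c).indicator (fun _ => ENNReal.ofReal (B₁ ^ 2 - B₂ ^ 2)) y := fun y hy => by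
      have e : ‖f y‖ₑ ^ (2 : ℝ) = ENNReal.ofReal (|f y| ^ 2) := by
        rw [Real.enorm_eq_ofReal_abs, ENNReal.ofReal_pow (abs_nonneg _)]
        norm_cast
      rw [e]
      by_cases hyc : y ≤ c
      · rw [indicator_of_mem (mem_Iic.2 hyc)]
        refine le_trans (ENNReal.ofReal_le_ofReal ?_) ENNReal.ofReal_add_le
        rw [add_sub_cancel]
        exact pow_le_pow_left₀ (abs_nonneg _) (h1 y hy hyc) 2
      · rw [indicator_of_notMem (by simpa using hyc), add_zero]
        exact ENNReal.ofReal_le_ofReal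
          (pow_le_pow_left₀ (abs_nonneg _) (h2 y hy (not_le.1 hyc)) 2)
    have hvol : volume (Iic c ∩ Ioo 0 1) ≤ ENNReal.ofReal c := by
      refine (measure_mono (t := Ioc 0 c) fun y hy => ⟨hy.2.1, hy.1⟩).trans ?_
      simp
    calc _ ≤ ∫⁻ y in Ioo (0 : ℝ) 1, (ENNReal.ofReal (B₂ ^ 2) +
          (Iic c).indicator (fun _ => ENNReal.ofReal (B₁ ^ 2 - B₂ ^ 2)) y) :=
          setLIntegral_mono' measurableSet_Ioo hpt
      _ = ENNReal.ofReal (B₂ ^ 2) +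
          ENNReal.ofReal (B₁ ^ 2 - B₂ ^ 2) * volume (Iic c ∩ Ioo 0 1) := by
        rw [lintegral_add_left measurable_const, lintegral_indicator_const measurableSet_Iic,
          Measure.restrict_apply measurableSet_Iic]
        simp
      _ ≤ ENNReal.ofReal (B₂ ^ 2) + ENNReal.ofReal (B₁ ^ 2 - B₂ ^ 2) * ENNReal.ofReal c := by
        gcongr
      _ ≤ ENNReal.ofReal (B₂ ^ 2) + ENNReal.ofReal (C ^ 2 - B₂ ^ 2) := by
        rw [← ENNReal.ofReal_mul' hc]
        gcongr
      _ = ENNReal.ofReal (C ^ 2) := by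
        rw [← ENNReal.ofReal_add (by positivity) (by linarith)]
        ring_nf
  rw [l2norm, eLpNorm_eq_lintegral_rpow_enorm_toReal (by norm_num) (by norm_num)]
  simp only [ENNReal.toReal_ofNat]
  calc _ ≤ (ENNReal.ofReal (C ^ 2)) ^ (1 / 2 : ℝ) := by gcongr
    _ = ENNReal.ofReal C := by
      rw [ENNReal.ofReal_rpow_of_nonneg (by positivity) (by norm_num), ← Real.sqrt_eq_rpow,
        Real.sqrt_sq hC]

lemma l2norm_registration_le {a b : ℝ} (ha : 0 < a) (hab : a < b) {T : ℝ → ℝ}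
    (hT : IsLayerTransport a (logMean a b) T) {u : ℝ → ℝ → ℝ}
    (hu : ∀ μ ∈ Icc a b, ∀ μ' ∈ Icc a b, ∀ x ∈ Icc (0 : ℝ) 1, ∀ x' ∈ Icc (0 : ℝ) 1,
      |u μ x - u μ' x'| ≤ |Real.exp (-(μ * x)) - Real.exp (-(μ' * x'))| + Real.exp (-a))
    {μ : ℝ} (hμ : μ ∈ Icc a b) :
    l2norm (fun y => u (logMean a b) y -
        u μ (y - modeWeight a (logMean a b) μ * (y - T y))) ≤
      ENNReal.ofReal (Real.exp (-a) * 4) := by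
  have ham := lt_logMean ha hab
  have hmb := logMean_lt ha hab
  have hK := logMean_ratio_sq_le ha hab
  set m := logMean a b
  have hE := Real.exp_pos (-a)
  have hma : 0 < m - a := sub_pos.2 ham
  have hm : 0 < m := ha.trans ham
  have hpt : ∀ y ∈ Ioo (0 : ℝ) 1, |u m y - u μ (y - modeWeight a m μ * (y - T y))| ≤
      |Real.exp (-(m * y)) - Real.exp (-(μ * (y - modeWeight a m μ * (y - T y))))| +
        Real.exp (-a) := fun y hy =>
    hu m ⟨ham.le, hmb.le⟩ μ hμ y (Ioo_subset_Icc_self hy) _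
      (Ioo_subset_Icc_self ((hT.bijOn ha ham hμ.1).mapsTo hy))
  rcases le_total μ m with hc | hc
  · have h3 : ∀ y ∈ Ioo (0 : ℝ) 1, |u m y - u μ (y - modeWeight a m μ * (y - T y))| ≤
        3 * Real.exp (-a) := fun y hy => by
      have := hT.exp_sub_exp_le ha ham hμ.1 hc (Ioo_subset_Icc_self hy)
      linarith [hpt y hy]
    refine l2norm_le_of_two_bounds (c := 0) (B₁ := 3 * Real.exp (-a)) (B₂ := 3 * Real.exp (-a))
      le_rfl (by positivity) (by nlinarith) (fun y hy _ => h3 y hy) (fun y hy _ => h3 y hy)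
      (by nlinarith)
  · set κ := (μ - m) / (m - a) with hκ
    have hκ0 : 0 ≤ κ := div_nonneg (sub_nonneg.2 hc) hma.le
    have hκK : κ ^ 2 ≤ 2 * (m / a) := by
      refine le_trans (pow_le_pow_left₀ hκ0 ?_ 2) hK
      exact div_le_div_of_nonneg_right (by linarith [hμ.2]) hma.le
    have hmin := fun y (hy : y ∈ Ioo (0 : ℝ) 1) =>
      hT.exp_sub_exp_le' ha ham hc (Ioo_subset_Icc_self hy)
    -- The cut is where `exp (-m y)` falls to `exp (-a)`. Each bound includes one `exp (-a)` for the
    -- profile error.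
    refine l2norm_le_of_two_bounds (c := a / m) (B₁ := (2 * κ + 1) * Real.exp (-a))
      (B₂ := 2 * Real.exp (-a)) (by positivity) (by positivity) (by nlinarith)
      (fun y hy _ => ?_) (fun y hy hyc => ?_) ?_
    · have := (hmin y hy).trans (min_le_right _ _)
      linarith [hpt y hy]
    · have h1 := (hmin y hy).trans (min_le_left _ _)
      have h2 : Real.exp (-(m * y)) ≤ Real.exp (-a) := by
        rw [div_lt_iff₀ hm] at hyc
        exact Real.exp_le_exp.2 (by linarith)
      linarith [hpt y hy]
    -- With `r = m / a`, from `κ² ≤ 2 r` and `κ ≤ r + 3/4` one gets `4 κ² + 4 κ - 3 ≤ 12 r`, so the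
    -- squared norm is at most `(4 + 12) exp (-2a)`.
    · have hκr : κ ≤ m / a + 3 / 4 := by
        refine le_of_sq_le_sq (hκK.trans ?_) (by positivity)
        nlinarith [sq_nonneg (m / a - 1 / 4)]
      have h4 : (2 * κ + 1) ^ 2 - 4 ≤ 12 * (m / a) := by nlinarith
      have h5 : ((2 * κ + 1) ^ 2 - 4) * (a / m) ≤ 12 := by
        calc _ ≤ 12 * (m / a) * (a / m) := by gcongr
          _ = 12 := by field_simp
      calc _ = ((2 * κ + 1) ^ 2 - 4) * (a / m) * Real.exp (-a) ^ 2 := by ring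
        _ ≤ 12 * Real.exp (-a) ^ 2 := by gcongr
        _ = _ := by ring

lemma abs_sub_le_abs_sub_add {x x' p p' E : ℝ} (h : |(x - p) - (x' - p')| ≤ E) :
    |x - x'| ≤ |p - p'| + E := by
  calc |x - x'| = |(p - p') + ((x - p) - (x' - p'))| := by ring_nf
    _ ≤ |p - p'| + |(x - p) - (x' - p')| := abs_add_le _ _
    _ ≤ _ := by gcongr

/-! ### The transport potential -/

lemma exists_centred_primitive {g : ℝ → ℝ} (hg : Continuous g) :
    ∃ ψ : ℝ → ℝ, (∀ y, HasDerivAt ψ (g y) y) ∧ IntegrableOn ψ (Ioo 0 1) ∧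
      ∫ y in Ioo (0 : ℝ) 1, ψ y = 0 := by
  set ψ₀ : ℝ → ℝ := fun y => ∫ v in (0 : ℝ)..y, g v
  have hd : ∀ y, HasDerivAt ψ₀ (g y) y := fun y => hg.integral_hasStrictDerivAt 0 y |>.hasDerivAt
  have hc : Continuous ψ₀ := continuous_iff_continuousAt.2 fun y => (hd y).continuousAt
  have hi : ∀ f : ℝ → ℝ, Continuous f → IntegrableOn f (Ioo 0 1) := fun f hf =>
    (hf.continuousOn.integrableOn_Icc (a := (0 : ℝ)) (b := 1)).mono_set Ioo_subset_Icc_self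
  refine ⟨fun y => ψ₀ y - ∫ y in Ioo (0 : ℝ) 1, ψ₀ y, fun y => (hd y).sub_const _,
    hi _ (by fun_prop), ?_⟩
  rw [integral_sub (hi _ hc) (integrable_const _)]
  simp

lemma isMongeMap_map {P G T : ℝ → ℝ} (hP : MonotoneOn P (Ioo 0 1)) (hG : MonotoneOn G (Ioo 0 1))
    (hP1 : ∀ v ∈ Ioo (0 : ℝ) 1, P v ∈ Icc (0 : ℝ) 1)
    (hG1 : ∀ v ∈ Ioo (0 : ℝ) 1, G v ∈ Icc (0 : ℝ) 1)
    (hT : Measurable T) (hTP : ∀ v ∈ Ioo (0 : ℝ) 1, T (P v) = G v) :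
    IsMongeMap (unitLeb.map P) (unitLeb.map G) T := by
  have hPm := aemeasurable_unitLeb_of_monotoneOn hP
  have hae : T ∘ P =ᵐ[unitLeb] G := by
    filter_upwards [ae_restrict_mem measurableSet_Ioo] with v hv using hTP v hv
  refine ⟨hT, ?_, ?_⟩
  · rw [AEMeasurable.map_map_of_aemeasurable hT.aemeasurable hPm, Measure.map_congr hae]
  · rw [otSq_map_map hP hG hP1 hG1, lintegral_map' (Measurable.aemeasurable (by fun_prop)) hPm]
    refine lintegral_congr_ae ?_
    filter_upwards [hae] with v hv
    rw [← hv, abs_sub_comm]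
    rfl

/-! ### Error bounds from a single mode -/

lemma registrationError_le {A : Set ℝ} {u : ℝ → ℝ → ℝ} {S : Submodule ℝ (ℝ → ℝ)} {v ψ g : ℝ → ℝ}
    {C : ℝ≥0∞} {w : ℝ → ℝ} (hψS : ψ ∈ S) (hψ : ∀ y, HasDerivAt ψ (g y) y)
    (hbij : ∀ μ ∈ A, BijOn (fun y => y - w μ * g y) (Ioo 0 1) (Ioo 0 1))
    (hC : ∀ μ ∈ A, l2norm (fun y => v y - u μ (y - w μ * g y)) ≤ C) :
    registrationError A u S v ≤ C := by
  have e : ∀ μ, invMap (w μ) ψ = fun y => y - w μ * g y := fun μ => by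
    ext y; rw [invMap, (hψ y).deriv]
  refine iInf₂_le_of_le ψ hψS (iSup₂_le fun μ hμ => ?_)
  refine iInf₂_le_of_le (w μ) (by rw [e]; exact hbij μ hμ) ?_
  simp only [e]
  exact hC μ hμ

/-- The lines through `v` and `ψ` serve as `V` and `W`, the weight being absorbed into the mode. The
width asks for dimension exactly one, hence the two nonvanishing hypotheses. -/
lemma nmWidth_one_one_le {A : Set ℝ} {u : ℝ → ℝ → ℝ} {S : Submodule ℝ (ℝ → ℝ)} {v ψ g : ℝ → ℝ}
    {C : ℝ≥0∞} {w : ℝ → ℝ} (hψS : ψ ∈ S) (hψ0 : ψ ≠ 0) (hψ : ∀ y, HasDerivAt ψ (g y) y)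
    (hv : MemLp v 2 (volume.restrict (Ioo 0 1))) (hv0 : ¬ v =ᵐ[volume.restrict (Ioo 0 1)] 0)
    (hbij : ∀ μ ∈ A, BijOn (fun y => y - w μ * g y) (Ioo 0 1) (Ioo 0 1))
    (hC : ∀ μ ∈ A, l2norm (fun y => v y - u μ (y - w μ * g y)) ≤ C) :
    nmWidth A u S 1 1 ≤ C := by
  have e : ∀ μ, invMap 1 (w μ • ψ) = fun y => y - w μ * g y := fun μ => by
    ext y
    rw [invMap, one_mul, ((hψ y).const_smul (w μ)).deriv, smul_eq_mul]
  have hv0' : hv.toLp v ≠ 0 := fun h => hv0 <|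
    (MemLp.toLp_eq_toLp_iff hv MemLp.zero).1 (by simpa using h)
  refine iInf₂_le_of_le (Submodule.span ℝ {hv.toLp v})
    ⟨inferInstance, finrank_span_singleton hv0'⟩ ?_
  refine iInf₂_le_of_le (Submodule.span ℝ {ψ})
    ⟨(Submodule.span_singleton_le_iff_mem _ _).2 hψS, inferInstance,
      finrank_span_singleton hψ0⟩ ?_
  refine iSup₂_le fun μ hμ => ?_
  refine iInf₂_le_of_le (w μ • ψ)
    (Submodule.smul_mem _ _ (Submodule.mem_span_singleton_self ψ)) ?_
  refine iInf_le_of_le (by rw [e]; exact hbij μ hμ) ?_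
  refine iInf₂_le_of_le (hv.toLp v) (Submodule.mem_span_singleton_self _) ?_
  refine le_trans (le_of_eq (eLpNorm_congr_ae ?_)) (hC μ hμ)
  filter_upwards [hv.coeFn_toLp] with y hy
  rw [hy, e]

/-- The boundary condition at `1` enters only through the quantile functions and the closeness `hu`
to exponentials. -/
theorem layer_registration {a b : ℝ} (ha : 0 < a) (hab : a < b) {Q : ℝ → ℝ → ℝ}
    (hQ : IsLayerQuantile Q) {u : ℝ → ℝ → ℝ} {ρ : ℝ → Measure ℝ}
    (hρ : ∀ μ ∈ Icc a b, ρ μ = unitLeb.map (Q μ))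
    (hode : ∀ μ ∈ Icc a b, SolvesODE μ (u μ))
    (hu : ∀ μ ∈ Icc a b, ∀ μ' ∈ Icc a b, ∀ x ∈ Icc (0 : ℝ) 1, ∀ x' ∈ Icc (0 : ℝ) 1,
      |u μ x - u μ' x'| ≤ |Real.exp (-(μ * x)) - Real.exp (-(μ' * x'))| + Real.exp (-a)) :
    (∃! ρbar, IsOTBarycenter (Icc a b) ρ ρbar) ∧
    ∀ ρbar, IsOTBarycenter (Icc a b) ρ ρbar →
      registrationError (Icc a b) u (potentialSpan (Icc a b) ρ ρbar) (u (logMean a b))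
          ≤ ENNReal.ofReal (Real.exp (-a) * 4) ∧
      nmWidth (Icc a b) u (potentialSpan (Icc a b) ρ ρbar) 1 1
          ≤ ENNReal.ofReal (Real.exp (-a) * 4) := by
  have hν := isProbabilityMeasure_uniformOn hab
  have hsub : Ioo (0 : ℝ) 1 ⊆ Icc 0 1 := Ioo_subset_Icc_self
  have hpos : ∀ μ ∈ Icc a b, 0 < μ := fun μ h => ha.trans_le h.1
  have hae := ae_uniformOn_mem a b
  have hbar : ∀ σ, IsOTBarycenter (Icc a b) ρ σ ↔ σ = unitLeb.map (averageQuantile Q a b) :=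
    isOTBarycenter_iff (ν := uniformOn a b) rfl hQ.measurable
      (hae.mono fun μ h v hv => hQ.mem_Icc (hpos μ h) (hsub hv))
      (hae.mono fun μ h => ((hQ.strictMonoOn μ (hpos μ h)).mono hsub).monotoneOn)
      (hae.mono hρ)
  refine ⟨⟨_, (hbar _).2 rfl, fun σ h => (hbar σ).1 h⟩, fun ρbar hρbar => ?_⟩
  rw [(hbar _).1 hρbar]
  obtain ⟨T, hT, hTQ⟩ := exists_layerTransport hQ ha hab
  have ham := lt_logMean ha hab
  have hmA : logMean a b ∈ Icc a b := ⟨ham.le, (logMean_lt ha hab).le⟩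
  have haA : a ∈ Icc a b := left_mem_Icc.2 hab.le
  have hTc := hT.continuous
  obtain ⟨ψ, hψ, hψi, hψ0⟩ := exists_centred_primitive (g := fun y => y - T y) (by fun_prop)
  have hmonge : IsMongeMap (unitLeb.map (averageQuantile Q a b)) (ρ a) T := by
    rw [hρ a haA]
    refine isMongeMap_map ((strictMonoOn_averageQuantile hQ ha hab).mono hsub).monotoneOn
      ((hQ.strictMonoOn a ha).mono hsub).monotoneOn (fun v hv => ?_)
      (fun v hv => hQ.mem_Icc ha (hsub hv)) hTc.measurable fun v hv => hTQ v (hsub hv)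
    exact average_mem_Icc hQ.measurable
      (hae.mono fun μ h v hv => hQ.mem_Icc (hpos μ h) (hsub hv)) v hv
  have hψS : ψ ∈ potentialSpan (Icc a b) ρ (unitLeb.map (averageQuantile Q a b)) :=
    Submodule.subset_span ⟨a, haA, ⟨T, hmonge, fun y _ => hψ y⟩, hψi, hψ0⟩
  have hψne : ψ ≠ 0 := by
    rintro rfl
    obtain ⟨y, -, hy⟩ := hT.exists_ne
    have := (hψ y).unique (hasDerivAt_const y (0 : ℝ))
    exact hy (by linarith)
  have hbij := fun μ (h : μ ∈ Icc a b) => hT.bijOn ha ham h.1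
  have hL2 := fun μ (h : μ ∈ Icc a b) => l2norm_registration_le ha hab hT hu h
  refine ⟨registrationError_le hψS hψ hbij hL2, ?_⟩
  have hmode := hode _ hmA
  have hcont := hmode.continuousOn
  refine nmWidth_one_one_le hψS hψne hψ ?_ ?_ hbij hL2
  · obtain ⟨C, hC⟩ := isCompact_Icc.exists_bound_of_continuousOn hcont
    refine MemLp.of_bound ((hcont.mono hsub).aestronglyMeasurable measurableSet_Ioo) C ?_
    filter_upwards [ae_restrict_mem measurableSet_Ioo] with y hy using hC y (hsub hy)
  · intro h0
    have h1 : EqOn (u (logMean a b)) 0 (Ioo 0 1) :=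
      Measure.eqOn_open_of_ae_eq h0 isOpen_Ioo (hcont.mono hsub) continuousOn_const
    have h2 := EqOn.of_subset_closure h1 hcont continuousOn_const hsub
      (by rw [closure_Ioo (by norm_num)]) (left_mem_Icc.2 zero_le_one)
    rw [hmode.left_end] at h2
    exact one_ne_zero h2

end BoundaryLayer

end

/-! ### The two boundary conditions and the final bound -/

theorem mainTheorem1 (μmin ε : ℝ) (hμmin : 1 < μmin) (hε0 : 0 < ε) (hε1 : ε < 1)
    (A : Set ℝ) (hA : A = Set.Icc μmin (μmin / ε ^ 2))
    (u : ℝ → ℝ → ℝ)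
    (hu : (∀ μ ∈ A, BoundaryLayer.IsDirichletSolution μ (u μ)) ∨
      (∀ μ ∈ A, BoundaryLayer.IsNeumannSolution μ (u μ)))
    (ρ : ℝ → MeasureTheory.Measure ℝ)
    (hρ : ρ = fun μ => BoundaryLayer.densityMeasure (u μ))
    (μbar : ℝ) (hμbar : μbar = BoundaryLayer.logMean μmin (μmin / ε ^ 2)) :
    μbar ∈ A ∧
    (∃! ρbar, BoundaryLayer.IsOTBarycenter A ρ ρbar) ∧
    ∀ ρbar, BoundaryLayer.IsOTBarycenter A ρ ρbar →
      BoundaryLayer.registrationError A u (BoundaryLayer.potentialSpan A ρ ρbar) (u μbar)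
          ≤ ENNReal.ofReal (Real.exp (-μmin) * (4 + ε)) ∧
      BoundaryLayer.nmWidth A u (BoundaryLayer.potentialSpan A ρ ρbar) 1 1
          ≤ ENNReal.ofReal (Real.exp (-μmin) * (4 + ε)) := by
  have ha : 0 < μmin := zero_lt_one.trans hμmin
  have hab : μmin < μmin / ε ^ 2 := by
    rw [lt_div_iff₀ (by positivity)]
    exact mul_lt_of_lt_one_right ha (pow_lt_one₀ hε0.le hε1 two_ne_zero)
  -- The estimate gives the constant `4`; the term `ε` is slack.
  have hle : ENNReal.ofReal (Real.exp (-μmin) * 4) ≤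
      ENNReal.ofReal (Real.exp (-μmin) * (4 + ε)) := by
    gcongr
    linarith
  subst hA hρ hμbar
  refine ⟨⟨(BoundaryLayer.lt_logMean ha hab).le, (BoundaryLayer.logMean_lt ha hab).le⟩, ?_⟩
  have hpos : ∀ μ ∈ Set.Icc μmin (μmin / ε ^ 2), 0 < μ := fun μ h => ha.trans_le h.1
  have hexp : ∀ μ ∈ Set.Icc μmin (μmin / ε ^ 2), Real.exp (-μ) ≤ Real.exp (-μmin) :=
    fun μ h => Real.exp_le_exp.2 (neg_le_neg h.1)
  have hlayer : ∃ Q, BoundaryLayer.IsLayerQuantile Q ∧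
      (∀ μ ∈ Icc μmin (μmin / ε ^ 2),
        BoundaryLayer.densityMeasure (u μ) = BoundaryLayer.unitLeb.map (Q μ)) ∧
      (∀ μ ∈ Icc μmin (μmin / ε ^ 2), BoundaryLayer.SolvesODE μ (u μ)) ∧
      ∀ μ ∈ Icc μmin (μmin / ε ^ 2), ∀ μ' ∈ Icc μmin (μmin / ε ^ 2),
        ∀ x ∈ Icc (0 : ℝ) 1, ∀ x' ∈ Icc (0 : ℝ) 1, |u μ x - u μ' x'| ≤
          |Real.exp (-(μ * x)) - Real.exp (-(μ' * x'))| + Real.exp (-μmin) := by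
    rcases hu with hu | hu
    · refine ⟨_, BoundaryLayer.isLayerQuantile_dirichlet,
        fun μ h => BoundaryLayer.densityMeasure_dirichlet (hpos μ h) (hu μ h),
        fun μ h => (hu μ h).1, fun μ h μ' h' x hx x' hx' =>
          BoundaryLayer.abs_sub_le_abs_sub_add ?_⟩
      -- Both profile errors have the same sign, so their difference costs `exp (-μmin)` only once.
      have h1 := BoundaryLayer.sinh_profile (hpos μ h) hx
      have h2 := BoundaryLayer.sinh_profile (hpos μ' h') hx'
      rw [(hu μ h).eqOn (hpos μ h) hx, (hu μ' h').eqOn (hpos μ' h') hx', abs_le]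
      constructor <;> linarith [h1.1, h1.2, h2.1, h2.2, hexp μ h, hexp μ' h']
    · refine ⟨_, BoundaryLayer.isLayerQuantile_neumann,
        fun μ h => BoundaryLayer.densityMeasure_neumann (hpos μ h) (hu μ h),
        fun μ h => (hu μ h).1, fun μ h μ' h' x hx x' hx' =>
          BoundaryLayer.abs_sub_le_abs_sub_add ?_⟩
      have h1 := BoundaryLayer.cosh_profile (hpos μ h) hx
      have h2 := BoundaryLayer.cosh_profile (hpos μ' h') hx'
      rw [(hu μ h).eqOn (hpos μ h) hx, (hu μ' h').eqOn (hpos μ' h') hx', abs_le]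
      constructor <;> linarith [h1.1, h1.2, h2.1, h2.2, hexp μ h, hexp μ' h']
  obtain ⟨Q, hQ, h1, h2, h3⟩ := hlayer
  have h := BoundaryLayer.layer_registration ha hab hQ h1 h2 h3
  exact ⟨h.1, fun ρbar hρbar =>
    ⟨(h.2 ρbar hρbar).1.trans hle, (h.2 ρbar hρbar).2.trans hle⟩⟩
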